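/- Let $d\ge 2$ and let $E_d$ be the set of nearest-neighbour edges $\{x,y\}$, $|x-y|=1$, of $\mathbb Z^d$. Let $(\omega_e)_{e\in E_d}$ be i.i.d. random conductances on a probability space $(\Omega,\mathcal F,\mathbb P)$ with $0<\omega_e\le 1$ almost surely and $\mathbb P(\omega_e\le u)=u^{\gamma}(1+o(1))$ as $u\downarrow 0$, for some $\gamma>0$. Write $x\sim y$ when $\{x,y\}\in E_d$, and $\omega_{xy}=\omega_{\{x,y\}}$. Put $\pi(x)=\sum_{y\sim x}\omega_{xy}$ and $$\mathcal L_\theta f(x)=\frac1{\theta(x)}\sum_{y\sim x}\omega_{xy}\,(f(y)-f(x)),$$ where $\theta=\pi$ for the constant speed random walk (CSRW) and $\theta\equiv 1$ for the variable speed random walk (VSRW). For $\xi>0$ let $\mathcal C^\xi$ be the infinite cluster of the graph of edges with $\omega_e\ge\xi$, that is, the set of sites whose connected component in this graph is infinite (for small $\xi$ this is almost surely the unique infinite component). Let $B_n=[-n,n]^d\cap\mathbb Z^d$ and $\mathcal H_n=B_n\setminus\mathcal C^\xi$ (the sites of $B_n$ that lie in holes). For $\lambda>0$ let $\lambda_1=\lambda_1(n,\xi,\lambda)$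 be the smallest eigenvalue of $-\mathcal L_\theta+\lambda\,\mathbf 1_{\mathcal C^\xi}$ with Dirichlet (zero) boundary condition outside $B_n$. If $\mathcal H_n\neq\emptyset$, let $\zeta_1=\zeta_1(n,\xi)$ be the smallest eigenvalue of $-\mathcal L_\theta$ with Dirichlet boundary condition outside $\mathcal H_n$. (1) CSRW. If $\gamma>\frac18\,\frac{d}{d-1/2}$, there is $\alpha\in(0,2)$, depending only on $d$ and $\gamma$, such that for all sufficiently small $\xi>0$, almost surely, for all $n$ large enough, $$\lambda_1\ge n^{-\alpha}\quad\text{for the choice }\lambda=\Big(1+\frac{8d}{\xi}\Big)n^{-\alpha},\qquad\text{and}\qquad \zeta_1\ge n^{-\alpha}\ \text{ if }\mathcal H_n\ne\emptyset .$$ (2) VSRW. If $\gamma>\frac14$, there is $\alpha\in(0,2)$, depending only on $d$ and $\gamma$, such that for all sufficiently small $\xi>0$, almost surely, for all $n$ large enough, $$\lambda_1\ge n^{-\alpha}\quad\text{for the choice }\lambda=3\,n^{-\alpha},\qquad\text{and}\qquad \zeta_1\ge n^{-\alpha}\ \text{ if }\mathcal H_n\ne\emptyset .$$ Here "sufficiently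 small" means $0<\xi<\xi_0$ with $\xi_0>0$ independent of the environment and of $n$, and "large enough" may depend on the environment and on $\xi$. -/

import Mathlib

open MeasureTheory ProbabilityTheory Filter Topology

universe u

namespace RCM

noncomputable section

/-- The hypercubic lattice `ℤ^d` with its nearest-neighbour edges `|x - y| = 1`. -/
def lattice (d : ℕ) : SimpleGraph (Fin d → ℤ) where
  Adj x y := ∑ i, |x i - y i| = 1
  symm := ⟨fun x y h => by simpa only [abs_sub_comm] using h⟩
  loopless := ⟨fun x h => by simp at h⟩

/-- The set `E_d` of unordered nearest-neighbour edges. -/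
abbrev Edge (d : ℕ) : Type := (lattice d).edgeSet

open scoped Classical in
/-- The (finitely many) nearest neighbours of `x`; see `mem_nbrs`. -/
def nbrs {d : ℕ} (x : Fin d → ℤ) : Finset (Fin d → ℤ) :=
  (Finset.Icc (x - 1) (x + 1)).filter fun y => (lattice d).Adj x y

theorem mem_nbrs {d : ℕ} {x y : Fin d → ℤ} : y ∈ nbrs x ↔ (lattice d).Adj x y := by
  classical
  refine ⟨fun h => (Finset.mem_filter.1 h).2, fun h => Finset.mem_filter.2 ⟨?_, h⟩⟩
  have key : ∀ i, |x i - y i| ≤ 1 := fun i => by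
    have h' : ∑ i, |x i - y i| = 1 := h
    rw [← h']
    exact Finset.single_le_sum (f := fun i => |x i - y i|) (fun j _ => abs_nonneg _)
      (Finset.mem_univ i)
  rw [Finset.mem_Icc]
  constructor <;> intro i <;> have := abs_le.1 (key i) <;>
    simp only [Pi.sub_apply, Pi.add_apply, Pi.one_apply] <;> omega

/-- The box `B_n = [-n, n]^d ∩ ℤ^d`. -/
def box (d n : ℕ) : Finset (Fin d → ℤ) :=
  Finset.Icc (fun _ => -(n : ℤ)) (fun _ => (n : ℤ))

/-- A family `ω` of random conductances on the edges of `ℤ^d` that is i.i.d., takes values in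
`(0, 1]` and has a polynomial lower tail at zero: `P(ω_e ≤ u) = u^γ (1 + o(1))` as `u ↓ 0`. -/
structure IsPolyTailEnvironment {Ω : Type u} [MeasurableSpace Ω] (P : Measure Ω) {d : ℕ}
    (γ : ℝ) (ω : Edge d → Ω → ℝ) : Prop where
  measurable : ∀ e, Measurable (ω e)
  indep : iIndepFun ω P
  identDistrib : ∀ e e', IdentDistrib (ω e) (ω e') P P
  mem_Ioc : ∀ e, ∀ᵐ w ∂P, ω e w ∈ Set.Ioc (0 : ℝ) 1
  tail : ∀ e, Tendsto (fun u : ℝ => P.real {w | ω e w ≤ u} / u ^ γ) (𝓝[>] 0) (𝓝 1)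

section Deterministic

variable {d : ℕ}

open scoped Classical in
/-- The conductance `c_{xy}` of the pair `x, y` (zero when `x, y` are not neighbours), for a
fixed realization `c` of the conductances. -/
def cond (c : Edge d → ℝ) (x y : Fin d → ℤ) : ℝ :=
  if h : (lattice d).Adj x y then c ⟨s(x, y), h⟩ else 0

/-- `π(x) = ∑_{y ∼ x} c_{xy}`, the reference measure of the constant speed random walk. -/
def condMeasure (c : Edge d → ℝ) (x : Fin d → ℤ) : ℝ := ∑ y ∈ nbrs x, cond c x y

/-- The counting measure `ν ≡ 1`, the reference measure of the variable speed random walk. -/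
def unitMeasure (_x : Fin d → ℤ) : ℝ := 1

/-- The generator `L_θ f(x) = θ(x)⁻¹ ∑_{y ∼ x} c_{xy} (f(y) - f(x))` : that of the CSRW for
`θ = π` and of the VSRW for `θ = 1`. -/
def generator (c : Edge d → ℝ) (θ : (Fin d → ℤ) → ℝ) :
    ((Fin d → ℤ) → ℝ) →ₗ[ℝ] ((Fin d → ℤ) → ℝ) where
  toFun f x := (θ x)⁻¹ * ∑ y ∈ nbrs x, cond c x y * (f y - f x)
  map_add' f g := by
    funext x
    simp only [Pi.add_apply, ← mul_add, ← Finset.sum_add_distrib]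
    congr 1
    exact Finset.sum_congr rfl fun y _ => by ring
  map_smul' a f := by
    funext x
    simp only [Pi.smul_apply, smul_eq_mul, RingHom.id_apply, Finset.mul_sum]
    exact Finset.sum_congr rfl fun y _ => by ring

/-- Multiplication of functions by `φ`. -/
def mulOp (φ : (Fin d → ℤ) → ℝ) : ((Fin d → ℤ) → ℝ) →ₗ[ℝ] ((Fin d → ℤ) → ℝ) :=
  LinearMap.mulLeft ℝ φ

/-- The operator `T` with Dirichlet boundary conditions outside `A`, acting on functions on `A`:
extend by zero outside `A`, apply `T`, restrict to `A`. -/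
def dirichletRestrict (A : Set (Fin d → ℤ))
    (T : ((Fin d → ℤ) → ℝ) →ₗ[ℝ] ((Fin d → ℤ) → ℝ)) : Module.End ℝ (A → ℝ) :=
  LinearMap.funLeft ℝ ℝ (Subtype.val : A → (Fin d → ℤ)) ∘ₗ T ∘ₗ
    Function.ExtendByZero.linearMap ℝ (Subtype.val : A → (Fin d → ℤ))

/-- The smallest eigenvalue of the operator `T` with Dirichlet boundary conditions outside `A`
(used for finite nonempty `A` and `T` symmetric with respect to `θ`). -/
def principalEigenvalue (A : Set (Fin d → ℤ))
    (T : ((Fin d → ℤ) → ℝ) →ₗ[ℝ] ((Fin d → ℤ) → ℝ)) : ℝ :=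
  sInf {μ : ℝ | (dirichletRestrict A T).HasEigenvalue μ}

/-- The percolation graph of the edges whose conductance is at least `ξ`. -/
def openGraph (c : Edge d → ℝ) (ξ : ℝ) : SimpleGraph (Fin d → ℤ) where
  Adj x y := ∃ h : (lattice d).Adj x y, ξ ≤ c ⟨s(x, y), h⟩
  symm := ⟨fun x y ⟨h, hc⟩ => ⟨h.symm, by
    have he : (⟨s(y, x), h.symm⟩ : Edge d) = ⟨s(x, y), h⟩ := Subtype.ext Sym2.eq_swap
    rw [he]; exact hc⟩⟩
  loopless := ⟨fun x ⟨h, _⟩ => (lattice d).loopless.irrefl x h⟩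

/-- The infinite cluster `C^ξ`: all sites whose connected component in the percolation graph of
edges of conductance at least `ξ` is infinite. -/
def cluster (c : Edge d → ℝ) (ξ : ℝ) : Set (Fin d → ℤ) :=
  {x | {y | (openGraph c ξ).Reachable x y}.Infinite}

/-- The holes in the box: `H_n = B_n ∩ H^ξ`, where `H^ξ` is the complement of `C^ξ`. -/
def holes (c : Edge d → ℝ) (ξ : ℝ) (n : ℕ) : Set (Fin d → ℤ) :=
  (box d n : Set (Fin d → ℤ)) \ cluster c ξ

/-- The principal eigenvalue `λ₁` of `-L_θ + lam · 1_{C^ξ}` with Dirichlet boundary conditions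
outside the box `B_n`. -/
def boxEigenvalue (c : Edge d → ℝ) (θ : (Fin d → ℤ) → ℝ) (ξ lam : ℝ) (n : ℕ) : ℝ :=
  principalEigenvalue (box d n : Set (Fin d → ℤ))
    (-(generator c θ - lam • mulOp ((cluster c ξ).indicator fun _ => 1)))

/-- The Dirichlet spectral gap `ζ₁` of `-L_θ` on the holes `H_n` of the box. -/
def holesEigenvalue (c : Edge d → ℝ) (θ : (Fin d → ℤ) → ℝ) (ξ : ℝ) (n : ℕ) : ℝ :=
  principalEigenvalue (holes c ξ n) (-(generator c θ))

end Deterministic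

end

end RCM

namespace RCM

noncomputable section

/-! Both bounds follow from one functional inequality on the box: the `θ`-mass of `f` is at most a
constant times its mass on the cluster plus an error factor times its Dirichlet energy. Let `u` be
about `n^(-β)` with `β < α < 2`. Suppose that every hole site `x` is matched, injectively, with a
cluster site `φ x`, and is joined to it by a walk of polylogarithmic length over bonds of
conductance at least `u`. Then `f x ^ 2 ≤ 2 f (φ x) ^ 2 + 2 (f x - f (φ x)) ^ 2`. The last square is
at most `L ^ 2 / u` times the energy near `x`, and a given site is near only polylogarithmically
many `x` (`sum_sq_le_of_matching`). The error factor is thus `n^β` up to logarithms, and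
multiplication by `n^(-α)` makes it at most `1`. The factor in front of the cluster mass becomes the
killing rate `λ`; for `ζ₁` the cluster mass is zero (`le_eigenvalues`, `le_principalEigenvalue`).

The condition on `γ` comes from leaving a single site. A box or path of polylogarithmic size
contains a bond below `u` with probability `n^(-βγ)` up to logarithms. For the VSRW a site is bad
when its `2d` straight rays are all blocked, and no such site exists if `d < 2dβγ`; some `β < 2`
satisfies this when `γ > 1/4`. For the CSRW the weight `π(x)` is at most `2d` times the conductance
to the best neighbour, so a first step there is paid for however small that conductance is. Only two
adjacent sites that are both blocked do harm, which takes `4d - 2` disjoint rays and gives `γ > d /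
(8d - 4)`.

Once a ray is open, nothing else restricts `γ`: among `K` disjoint parallel lines or slabs one is
open everywhere in the box if `βγK > d`, with `K` free, and these link the rays (`near_of_hasRay`).
The matching exists because, for small `ξ`, at least half of every segment of length of order `(log
n)^2` lies in the cluster (`measure_not_densityGood_le`, `exists_matching`). This is a Peierls
argument in a coordinate plane (`exists_contour`). Borel–Cantelli along dyadic scales gives the
almost sure statements. -/

/-! ### Planar contours around finite clusters. -/

/-- Bonds of the planar lattice, given by the lower-left endpoint and the orientation
(`false` for horizontal, `true` for vertical). -/
abbrev PlaneBond : Type := (ℤ × ℤ) × Bool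

/-- The upper-right endpoint of a planar bond. -/
def PlaneBond.tip : PlaneBond → ℤ × ℤ
  | (p, false) => (p.1 + 1, p.2)
  | (p, true) => (p.1, p.2 + 1)

/-- The subgraph of the planar lattice formed by the bonds in `O`. -/
def planeGraph (O : Set PlaneBond) : SimpleGraph (ℤ × ℤ) :=
  SimpleGraph.fromRel fun p q => ∃ o, (p, o) ∈ O ∧ q = PlaneBond.tip (p, o)

theorem PlaneBond.tip_ne (b : PlaneBond) : b.1 ≠ b.tip := by
  rcases b with ⟨⟨a, b⟩, _ | _⟩ <;> simp [PlaneBond.tip]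

theorem planeGraph_adj_of_mem {O : Set PlaneBond} {b : PlaneBond} (hb : b ∈ O) :
    (planeGraph O).Adj b.1 b.tip :=
  (SimpleGraph.fromRel_adj _ _ _).2 ⟨b.tip_ne, Or.inl ⟨b.2, hb, rfl⟩⟩

theorem exists_bond_of_planeGraph_adj {O : Set PlaneBond} {p q : ℤ × ℤ}
    (h : (planeGraph O).Adj p q) :
    ∃ b ∈ O, (p = b.1 ∧ q = b.tip) ∨ (q = b.1 ∧ p = b.tip) := by
  obtain ⟨-, ⟨o, ho, h⟩ | ⟨o, ho, h⟩⟩ := (SimpleGraph.fromRel_adj _ _ _).1 h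
  · exact ⟨_, ho, Or.inl ⟨rfl, h⟩⟩
  · exact ⟨_, ho, Or.inr ⟨rfl, h⟩⟩

theorem eq_of_planeGraph_reachable {O : Set PlaneBond} {α : Type*} {g : ℤ × ℤ → α}
    (hg : ∀ b ∈ O, g b.tip = g b.1) {p q : ℤ × ℤ} (h : (planeGraph O).Reachable p q) :
    g p = g q := by
  obtain ⟨w⟩ := h
  induction w with
  | nil => rfl
  | cons h _ ih =>
    obtain ⟨b, hb, ⟨rfl, rfl⟩ | ⟨rfl, rfl⟩⟩ := exists_bond_of_planeGraph_adj h
    · rw [← ih, hg b hb]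
    · rw [← ih, hg b hb]

/-- The bonds that lie near `b`; they include all bonds sharing a unit square with `b`. -/
def starNbrs (b : PlaneBond) : Finset PlaneBond :=
  (Finset.Icc (b.1.1 - 1) (b.1.1 + 1) ×ˢ Finset.Icc (b.1.2 - 1) (b.1.2 + 1)) ×ˢ Finset.univ

theorem mem_starNbrs {b b' : PlaneBond} : b' ∈ starNbrs b ↔
    (b.1.1 - 1 ≤ b'.1.1 ∧ b'.1.1 ≤ b.1.1 + 1) ∧ b.1.2 - 1 ≤ b'.1.2 ∧ b'.1.2 ≤ b.1.2 + 1 := by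
  simp [starNbrs]

theorem card_starNbrs (b : PlaneBond) : (starNbrs b).card = 18 := by
  simp only [starNbrs, Finset.card_product, Int.card_Icc, Finset.card_univ, Fintype.card_bool]
  have h (a : ℤ) : (a + 1 + 1 - (a - 1)).toNat = 3 := by omega
  rw [h, h]

/-- The sets of bonds visited by the `n`-step paths of nearby bonds started at `b`. -/
def starSets : ℕ → PlaneBond → Finset (Finset PlaneBond)
  | 0, b => {{b}}
  | n + 1, b => (starNbrs b).biUnion fun b' => (starSets n b').image (insert b)

theorem card_starSets_le (n : ℕ) (b : PlaneBond) : (starSets n b).card ≤ 18 ^ n := by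
  induction n generalizing b with
  | zero => simp [starSets]
  | succ n ih =>
    calc _ ≤ ∑ b' ∈ starNbrs b, ((starSets n b').image (insert b)).card :=
          Finset.card_biUnion_le
      _ ≤ ∑ _b' ∈ starNbrs b, 18 ^ n :=
          Finset.sum_le_sum fun b' _ => Finset.card_image_le.trans (ih b')
      _ = 18 ^ (n + 1) := by
          rw [Finset.sum_const, card_starNbrs, smul_eq_mul, pow_succ, mul_comm]

theorem dist_le_of_mem_starSets {n : ℕ} {b b' : PlaneBond} {F : Finset PlaneBond}
    (hF : F ∈ starSets n b) (hb' : b' ∈ F) :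
    |b'.1.1 - b.1.1| ≤ n ∧ |b'.1.2 - b.1.2| ≤ n := by
  induction n generalizing b F with
  | zero =>
    simp only [starSets, Finset.mem_singleton] at hF
    subst hF
    rw [Finset.mem_singleton] at hb'
    simp [hb']
  | succ n ih =>
    simp only [starSets, Finset.mem_biUnion, Finset.mem_image] at hF
    obtain ⟨b₁, hb₁, F', hF', rfl⟩ := hF
    rw [mem_starNbrs] at hb₁
    rcases Finset.mem_insert.1 hb' with rfl | h
    · simp; omega
    · have := ih hF' h
      simp only [abs_le] at this ⊢
      push_cast
      omega

/-- Two bonds of `T` are adjacent when they are near each other. -/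
def starGraph (T : Set PlaneBond) : SimpleGraph PlaneBond where
  Adj b b' := b ≠ b' ∧ b' ∈ starNbrs b ∧ b ∈ T ∧ b' ∈ T
  symm := ⟨fun b b' h => ⟨h.1.symm, by have := h.2.1; rw [mem_starNbrs] at this ⊢; omega,
    h.2.2.2, h.2.2.1⟩⟩
  loopless := ⟨fun _ h => h.1 rfl⟩

theorem support_mem_starSets {T : Set PlaneBond} {b b' : PlaneBond}
    (p : (starGraph T).Walk b b') : p.support.toFinset ∈ starSets p.length b := by
  induction p with
  | nil => simp [starSets]
  | cons h p ih =>
    simp only [SimpleGraph.Walk.support_cons, List.toFinset_cons, SimpleGraph.Walk.length_cons,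
      starSets, Finset.mem_biUnion, Finset.mem_image]
    exact ⟨_, h.2.1, _, ih, rfl⟩

theorem mem_of_mem_support_starGraph {T : Set PlaneBond} {b b' : PlaneBond} (hb : b ∈ T)
    (p : (starGraph T).Walk b b') : ∀ e ∈ p.support, e ∈ T := by
  induction p with
  | nil => simpa using hb
  | cons h p ih =>
    intro e he
    rcases List.mem_cons.1 (by simpa using he) with rfl | he
    · exact hb
    · exact ih h.2.2.2 e he

theorem dist_le_length_starGraph {T : Set PlaneBond} {b b' : PlaneBond}
    (p : (starGraph T).Walk b b') : |b'.1.1 - b.1.1| ≤ p.length := by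
  induction p with
  | nil => simp
  | cons h p ih =>
    have := mem_starNbrs.1 h.2.1
    rw [abs_le] at ih ⊢
    push_cast [SimpleGraph.Walk.length_cons]
    omega

/-- One step changes the horizontal coordinate by at most `1`, so a path that travels far has at
least `n` steps. Cutting a self-avoiding one after `n` steps yields exactly `n + 1` distinct bonds,
the count that the union bound needs. -/
theorem exists_starSet_of_reachable {T : Set PlaneBond} {b b' : PlaneBond} (hb : b ∈ T)
    (h : (starGraph T).Reachable b b') {n : ℕ} (hn : (n : ℤ) ≤ |b'.1.1 - b.1.1|) :
    ∃ F ∈ starSets n b, F.card = n + 1 ∧ ∀ e ∈ F, e ∈ T := by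
  classical
  obtain ⟨p, hp⟩ := h.exists_isPath
  have hlen : n ≤ p.length := by exact_mod_cast hn.trans (dist_le_length_starGraph p)
  have hl : (p.take n).length = n := by simp [hlen]
  refine ⟨(p.take n).support.toFinset, ?_, ?_, fun e he => ?_⟩
  · simpa only [hl] using support_mem_starSets (p.take n)
  · rw [List.toFinset_card_of_nodup (hp.take n).support_nodup, SimpleGraph.Walk.length_support, hl]
  · exact mem_of_mem_support_starGraph hb _ e (List.mem_toFinset.1 he)

theorem exists_int_primitive (a : ℤ → ℤ) : ∃ s : ℤ → ℤ, s 0 = 0 ∧ ∀ i, s (i + 1) - s i = a i := by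
  refine ⟨fun i => ∑ j ∈ Finset.Ico 0 i, a j - ∑ j ∈ Finset.Ico i 0, a j, by simp, fun i => ?_⟩
  rcases le_or_gt 0 i with hi | hi
  · have h1 : Finset.Ico 0 (i + 1) = insert i (Finset.Ico 0 i) := by ext; simp; omega
    have h2 : Finset.Ico (i + 1) 0 = ∅ := by simp; omega
    have h3 : Finset.Ico i 0 = ∅ := by simp; omega
    dsimp only; rw [h1, h2, h3, Finset.sum_insert (by simp)]; simp
  · have h1 : Finset.Ico i 0 = insert i (Finset.Ico (i + 1) 0) := by ext; simp; omega
    have h2 : Finset.Ico 0 (i + 1) = ∅ := by simp; omega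
    have h3 : Finset.Ico 0 i = ∅ := by simp; omega
    dsimp only; rw [h1, h2, h3, Finset.sum_insert (by simp)]; simp

/-- The discrete Poincaré lemma in the plane. -/
theorem exists_plane_primitive (σ : PlaneBond → ℤ)
    (hσ : ∀ a b, σ ((a, b), false) + σ ((a + 1, b), true)
      = σ ((a, b), true) + σ ((a, b + 1), false)) :
    ∃ g : ℤ × ℤ → ℤ, ∀ b : PlaneBond, g b.tip - g b.1 = σ b := by
  obtain ⟨s, -, hs⟩ := exists_int_primitive fun a => σ ((a, 0), false)
  choose t ht0 ht using fun a => exists_int_primitive fun b => σ ((a, b), true)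
  refine ⟨fun p => s p.1 + t p.1 p.2, ?_⟩
  rintro ⟨⟨a, b⟩, _ | _⟩
  · simp only [PlaneBond.tip]
    induction b using Int.induction_on with
    | zero => rw [ht0, ht0, ← hs]; ring
    | succ i ih => have := hσ a i; have h1 := ht a i; have h2 := ht (a + 1) i; linarith
    | pred i ih =>
      have := hσ a (-i - 1); have h1 := ht a (-i - 1); have h2 := ht (a + 1) (-i - 1)
      simp only [sub_add_cancel] at this h1 h2
      linarith
  · simp only [PlaneBond.tip]
    have := ht a b
    linarith

theorem planeGraph_reachable_horizontal {O : Set PlaneBond} {b a a' : ℤ} (h : a ≤ a')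
    (hO : ∀ i, a ≤ i → i < a' → ((i, b), false) ∈ O) :
    (planeGraph O).Reachable (a, b) (a', b) := by
  induction a', h using Int.leInduction with
  | base => rfl
  | succ i hi ih =>
    exact (ih fun j h1 h2 => hO j h1 (by omega)).trans
      (planeGraph_adj_of_mem (hO i hi (by omega))).reachable

theorem planeGraph_reachable_vertical {O : Set PlaneBond} {a b b' : ℤ} (h : b ≤ b')
    (hO : ∀ i, b ≤ i → i < b' → ((a, i), true) ∈ O) :
    (planeGraph O).Reachable (a, b) (a, b') := by
  induction b', h using Int.leInduction with
  | base => rfl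
  | succ i hi ih =>
    exact (ih fun j h1 h2 => hO j h1 (by omega)).trans
      (planeGraph_adj_of_mem (hO i hi (by omega))).reachable

theorem exists_last_nat {A : Set (ℤ × ℤ)} (hA : A.Finite) (s : ℤ) (hs : s ≠ 0)
    (h0 : ((0, 0) : ℤ × ℤ) ∈ A) :
    ∃ j : ℕ, (s * j, 0) ∈ A ∧ ∀ i : ℕ, j < i → (s * i, (0 : ℤ)) ∉ A := by
  have hf : {j : ℕ | (s * j, (0 : ℤ)) ∈ A}.Finite :=
    hA.preimage (f := fun j : ℕ => (s * (j : ℤ), (0 : ℤ))) fun a _ b _ h => by simpa [hs] using h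
  obtain ⟨j, hj, hmax⟩ := hf.exists_maximalFor id _ ⟨0, by simpa using h0⟩
  exact ⟨j, hj, fun i hi hiA => absurd (hmax hiA hi.le) (by simpa using hi)⟩

/-- If the cluster of the origin in the planar graph `O` is finite, then it is surrounded by a
contour of bonds outside `O`, part of which is a long path started on the horizontal axis. -/
theorem exists_contour {O : Set PlaneBond}
    (hfin : {p | (planeGraph O).Reachable (0, 0) p}.Finite) :
    ∃ j : ℕ, ∃ F ∈ starSets j ((j, 0), false), F.card = j + 1 ∧ ∀ e ∈ F, e ∉ O := by
  classical
  set A := {p | (planeGraph O).Reachable (0, 0) p} with hAdef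
  have h0 : ((0, 0) : ℤ × ℤ) ∈ A := SimpleGraph.Reachable.refl _
  obtain ⟨j, hj, hjmax⟩ := exists_last_nat hfin 1 one_ne_zero h0
  obtain ⟨j', hj', hjmax'⟩ := exists_last_nat hfin (-1) (by norm_num) h0
  have hjmax : ∀ i : ℤ, j < i → (i, (0 : ℤ)) ∉ A := fun i hi => by
    lift i to ℕ using by omega
    simpa using hjmax i (by omega)
  have hjmax' : ∀ i : ℤ, i < -j' → (i, (0 : ℤ)) ∉ A := fun i hi => by
    obtain ⟨i, rfl⟩ : ∃ l, i = -l := ⟨-i, by ring⟩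
    lift i to ℕ using by omega
    simpa using hjmax' i (by omega)
  obtain ⟨M, hM0, hM⟩ : ∃ M : ℤ, 0 ≤ M ∧ ∀ p ∈ A, |p.1| < M ∧ |p.2| < M := by
    refine ⟨∑ p ∈ hfin.toFinset, (|p.1| + |p.2| + 1), by positivity, fun p hp => ?_⟩
    have := Finset.single_le_sum (f := fun p : ℤ × ℤ => |p.1| + |p.2| + 1)
      (fun _ _ => by positivity) (hfin.mem_toFinset.2 hp)
    have h1 := abs_nonneg p.1
    have h2 := abs_nonneg p.2
    constructor <;> omega
  have hout : ∀ p : ℤ × ℤ, M ≤ |p.1| ∨ M ≤ |p.2| → p ∉ A := fun p hp hpA => by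
    have := hM p hpA; omega
  have hjM : (j : ℤ) < M := by simpa using (hM _ hj).1
  have hjM' : (j' : ℤ) < M := by simpa using (hM _ hj').1
  -- the outer component of the complement
  set D := planeGraph {b | b.1 ∉ A ∧ b.tip ∉ A} with hD
  set B := {q | D.Reachable ((j : ℤ) + 1, 0) q} with hB
  have hBA : ∀ q ∈ B, q ∉ A := fun q hq => by
    have := eq_of_planeGraph_reachable (g := fun q => q ∈ A) (fun b hb => by
      have h1 := hb.1; have h2 := hb.2; simp [h1, h2]) hq
    simpa only [← this] using hjmax _ (by omega)
  -- The route leaves `A` behind: out along the axis, over the top of the square of half-side `M`,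
  -- and back along the axis from the left.
  have hleft : (-(j' : ℤ) - 1, (0 : ℤ)) ∈ B := by
    have s1 : D.Reachable ((j : ℤ) + 1, 0) (M, 0) :=
      planeGraph_reachable_horizontal (by omega) fun i h1 h2 =>
        ⟨hjmax _ (by omega), hjmax _ (by omega)⟩
    have s2 : D.Reachable (M, 0) (M, M) :=
      planeGraph_reachable_vertical hM0 fun i h1 h2 =>
        ⟨hout _ (Or.inl (le_abs_self _)), hout _ (Or.inl (le_abs_self _))⟩
    have s3 : D.Reachable (-M, M) (M, M) :=
      planeGraph_reachable_horizontal (by omega) fun i h1 h2 =>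
        ⟨hout _ (Or.inr (le_abs_self _)), hout _ (Or.inr (le_abs_self _))⟩
    have s4 : D.Reachable (-M, 0) (-M, M) :=
      planeGraph_reachable_vertical hM0 fun i h1 h2 =>
        ⟨hout _ (Or.inl (by simp [le_abs_self])), hout _ (Or.inl (by
          simp [PlaneBond.tip, le_abs_self]))⟩
    have s5 : D.Reachable (-M, 0) (-(j' : ℤ) - 1, 0) :=
      planeGraph_reachable_horizontal (by omega) fun i h1 h2 =>
        ⟨hjmax' _ (by omega), hjmax' _ (by omega)⟩
    exact (s1.trans (s2.trans (s3.symm.trans (s4.symm.trans s5))))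
  have hright : ((j : ℤ) + 1, (0 : ℤ)) ∈ B := SimpleGraph.Reachable.refl _
  -- the bonds of the contour
  set T : Set PlaneBond := {b | ¬ (b.1 ∈ B ↔ b.tip ∈ B)} with hT
  have hTA : ∀ b ∈ T, b.1 ∈ A ∨ b.tip ∈ A := fun b hb => by
    by_contra! hcon
    have hadj : D.Adj b.1 b.tip := planeGraph_adj_of_mem hcon
    exact hb ⟨fun h => SimpleGraph.Reachable.trans h hadj.reachable,
      fun h => SimpleGraph.Reachable.trans h hadj.symm.reachable⟩
  have hTO : ∀ b ∈ T, b ∉ O := fun b hb hbO => by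
    have hadj := planeGraph_adj_of_mem hbO
    have hboth : b.1 ∈ A ∧ b.tip ∈ A := by
      rcases hTA b hb with h | h
      · exact ⟨h, SimpleGraph.Reachable.trans h hadj.reachable⟩
      · exact ⟨SimpleGraph.Reachable.trans h hadj.symm.reachable, h⟩
    exact hb ⟨fun h => absurd hboth.1 (hBA _ h), fun h => absurd hboth.2 (hBA _ h)⟩
  set b₀ : PlaneBond := (((j : ℤ), 0), false) with hb₀
  set b₁ : PlaneBond := ((-(j' : ℤ) - 1, 0), false) with hb₁
  have hjA : ((j : ℤ), (0 : ℤ)) ∈ A := by simpa using hj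
  have hjA' : (-(j' : ℤ), (0 : ℤ)) ∈ A := by simpa using hj'
  have hjB : ((j : ℤ), (0 : ℤ)) ∉ B := fun h => hBA _ h hjA
  have hjB' : (-(j' : ℤ), (0 : ℤ)) ∉ B := fun h => hBA _ h hjA'
  have hb₀T : b₀ ∈ T := fun h => hjB (h.2 hright)
  -- It remains to see that the crossing `b₁` on the left lies in the same star-component of the
  -- contour as `b₀`.
  set S : Set PlaneBond := {b | (starGraph T).Reachable b₀ b} with hS
  have hST : ∀ b ∈ S, b ∈ T := fun b hb => by
    obtain ⟨p⟩ := hb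
    exact mem_of_mem_support_starGraph hb₀T p b p.end_mem_support
  have hSstep : ∀ b b', b ∈ S → b' ∈ T → b' ∈ starNbrs b → b' ∈ S := fun b b' hb hb' hn => by
    by_cases h : b = b'
    · exact h ▸ hb
    · exact SimpleGraph.Reachable.trans hb
        (show (starGraph T).Adj b b' from ⟨h, hn, hST b hb, hb'⟩).reachable
  let χ : ℤ × ℤ → ℤ := fun q => if q ∈ B then 1 else 0
  -- This is the gradient of the indicator of `B`, kept on one star-component only. It is still
  -- curl-free: the bonds of a unit square are star-neighbours, so those among them in `T` are all
  -- kept or all dropped. Hence it has a primitive `g`.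
  let σ : PlaneBond → ℤ := fun b => if b ∈ S then χ b.tip - χ b.1 else 0
  have hσT : ∀ b, b ∉ T → σ b = 0 := fun b hb => if_neg fun h => hb (hST b h)
  have hχT : ∀ b, b ∉ T → χ b.tip - χ b.1 = 0 := fun b hb => by
    have : b.1 ∈ B ↔ b.tip ∈ B := by simpa [hT] using hb
    simp only [χ, this, sub_self]
  obtain ⟨g, hg⟩ := exists_plane_primitive σ fun a b => by
    by_cases hsq : ∃ e : PlaneBond, e ∈ S ∧ (e = ((a, b), false) ∨ e = ((a + 1, b), true) ∨
        e = ((a, b), true) ∨ e = ((a, b + 1), false))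
    · obtain ⟨e, heS, he⟩ := hsq
      have key : ∀ e' : PlaneBond, e' ∈ starNbrs e → σ e' = χ e'.tip - χ e'.1 := fun e' he' => by
        by_cases hT' : e' ∈ T
        · exact if_pos (hSstep e e' heS hT' he')
        · rw [hσT e' hT', hχT e' hT']
      rw [key, key, key, key]
      · simp only [PlaneBond.tip]; ring
      all_goals
        rw [mem_starNbrs]
        rcases he with rfl | rfl | rfl | rfl <;> simp <;> omega
    · push Not at hsq
      simp only [σ]
      rw [if_neg fun h => (hsq _ h).1 rfl, if_neg fun h => (hsq _ h).2.1 rfl,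
        if_neg fun h => (hsq _ h).2.2.1 rfl, if_neg fun h => (hsq _ h).2.2.2 rfl]
  -- Contour bonds are neither in `O` nor in `D`, so `g` is constant on `A` and on `B`. It jumps by
  -- `1` across `b₀`, hence also across `b₁`, which forces `b₁ ∈ S`.
  have hgA : g (j, 0) = g (-(j' : ℤ), 0) :=
    eq_of_planeGraph_reachable (fun b hb => by
      have := hg b; rw [hσT b fun h => hTO b h hb] at this; omega)
      (SimpleGraph.Reachable.trans (SimpleGraph.Reachable.symm hjA) hjA')
  have hgB : g ((j : ℤ) + 1, 0) = g (-(j' : ℤ) - 1, 0) :=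
    eq_of_planeGraph_reachable (fun b hb => by
      have := hg b
      rw [hσT b fun h => (hTA b h).elim hb.1 hb.2] at this; omega) hleft
  have h0σ : g ((j : ℤ) + 1, 0) - g (j, 0) = 1 := by
    have := hg b₀
    rw [show σ b₀ = χ b₀.tip - χ b₀.1 from if_pos (SimpleGraph.Reachable.refl _)] at this
    simpa [b₀, χ, PlaneBond.tip, hjB, hright] using this
  have hb₁S : b₁ ∈ S := by
    by_contra hcon
    have := hg b₁
    rw [show σ b₁ = 0 from if_neg hcon] at this
    simp only [b₁, PlaneBond.tip, sub_add_cancel] at this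
    omega
  obtain ⟨F, hF, hcard, hFT⟩ := exists_starSet_of_reachable (n := j) hb₀T hb₁S (by
    simp only [b₀, b₁]
    rw [abs_sub_comm]
    exact (by omega : (j : ℤ) ≤ j - (-(j' : ℤ) - 1)).trans (le_abs_self _))
  exact ⟨j, F, hF, hcard, fun e he => hTO e (hFT e he)⟩

/-! ### Bonds and boxes -/

/-- A bond of `ℤ^d`, given by its lower endpoint and its direction. -/
abbrev Bond (d : ℕ) : Type := (Fin d → ℤ) × Fin d

theorem lattice_adj_add_single {d : ℕ} (p : Fin d → ℤ) (i : Fin d) :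
    (lattice d).Adj p (p + Pi.single i 1) := by
  change ∑ j, |p j - (p + Pi.single i 1 : Fin d → ℤ) j| = 1
  rw [Finset.sum_eq_single i]
  · simp
  · intro j _ hj; simp [hj]
  · simp

/-- The lattice edge of a bond. -/
def Bond.edge {d : ℕ} (b : Bond d) : Edge d :=
  ⟨s(b.1, b.1 + Pi.single b.2 1), lattice_adj_add_single b.1 b.2⟩

theorem Bond.edge_injective {d : ℕ} : Function.Injective (Bond.edge (d := d)) := by
  rintro ⟨p, i⟩ ⟨q, j⟩ h
  have h := congrArg Subtype.val h
  simp only [Bond.edge] at h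
  rcases Sym2.eq_iff.1 h with ⟨rfl, h⟩ | ⟨h1, h2⟩
  · have h := add_left_cancel h
    have : i = j := by
      by_contra hij
      have := congrFun h i
      simp [hij] at this
    rw [this]
  · exfalso
    have e1 := congrFun h1 j
    have e2 := congrFun h2 j
    simp only [Pi.add_apply, Pi.single_apply, if_true] at e1 e2
    split_ifs at e2 <;> omega

theorem exists_bond_of_adj {d : ℕ} {x y : Fin d → ℤ} (h : (lattice d).Adj x y) :
    ∃ i, y = x + Pi.single i 1 ∨ x = y + Pi.single i 1 := by
  have h' : ∑ i, |x i - y i| = 1 := h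
  obtain ⟨i, hi⟩ : ∃ i, |x i - y i| ≠ 0 := by
    by_contra! hcon
    simp [hcon] at h'
  rw [← Finset.add_sum_erase _ _ (Finset.mem_univ i)] at h'
  have hpos : 0 ≤ ∑ j ∈ Finset.univ.erase i, |x j - y j| :=
    Finset.sum_nonneg fun _ _ => abs_nonneg _
  have hi0 := abs_nonneg (x i - y i)
  have h1 : |x i - y i| = 1 := by omega
  have h0 : ∑ j ∈ Finset.univ.erase i, |x j - y j| = 0 := by omega
  have hz : ∀ j, j ≠ i → x j = y j := fun j hj => by
    have := (Finset.sum_eq_zero_iff_of_nonneg fun _ _ => abs_nonneg _).1 h0 j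
      (Finset.mem_erase.2 ⟨hj, Finset.mem_univ _⟩)
    have := abs_eq_zero.1 this
    omega
  refine ⟨i, ?_⟩
  rcases (abs_eq one_pos.le).1 h1 with h1 | h1
  · right
    funext j
    by_cases hj : j = i
    · subst hj; simp; omega
    · simp [hj, hz j hj]
  · left
    funext j
    by_cases hj : j = i
    · subst hj; simp; omega
    · simp [hj, hz j hj]

/-- The bonds inside the box `[lo, hi]`. -/
def boxBonds {d : ℕ} (lo hi : Fin d → ℤ) : Finset (Bond d) :=
  (Finset.Icc lo hi ×ˢ Finset.univ).filter fun b => b.1 + Pi.single b.2 1 ∈ Finset.Icc lo hi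

theorem mem_boxBonds {d : ℕ} {lo hi : Fin d → ℤ} {b : Bond d} : b ∈ boxBonds lo hi ↔
    ∀ l, lo l ≤ b.1 l ∧ b.1 l + Pi.single (M := fun _ => ℤ) b.2 1 l ≤ hi l := by
  simp only [boxBonds, Finset.mem_filter, Finset.mem_product, Finset.mem_Icc, Finset.mem_univ,
    and_true, Pi.le_def, Pi.add_apply]
  constructor
  · exact fun h l => ⟨h.1.1 l, h.2.2 l⟩
  · intro h
    have h0 : ∀ l, 0 ≤ Pi.single (M := fun _ => ℤ) b.2 1 l := fun l => by
      rw [Pi.single_apply]; split_ifs <;> simp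
    refine ⟨⟨fun l => (h l).1, fun l => ?_⟩, fun l => ?_, fun l => (h l).2⟩
    · have := h l; have := h0 l; omega
    · have := h l; have := h0 l; omega

theorem mem_boxBonds_dir {d : ℕ} {lo hi : Fin d → ℤ} {b : Bond d} (h : b ∈ boxBonds lo hi) :
    lo b.2 ≤ b.1 b.2 ∧ b.1 b.2 + 1 ≤ hi b.2 := by
  simpa using mem_boxBonds.1 h b.2

theorem mem_boxBonds_le {d : ℕ} {lo hi : Fin d → ℤ} {b : Bond d} (h : b ∈ boxBonds lo hi)
    (l : Fin d) : lo l ≤ b.1 l ∧ b.1 l ≤ hi l := by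
  have h1 := mem_boxBonds.1 h l
  have h0 : 0 ≤ Pi.single (M := fun _ => ℤ) b.2 1 l := by
    rw [Pi.single_apply]; split_ifs <;> simp
  omega

theorem card_boxBonds_le {d : ℕ} {lo hi : Fin d → ℤ} {M : ℕ} (h : ∀ l, hi l ≤ lo l + 2 * M) :
    (boxBonds lo hi).card ≤ d * (2 * M + 1) ^ d := by
  calc _ ≤ (Finset.Icc lo hi ×ˢ (Finset.univ : Finset (Fin d))).card := Finset.card_filter_le _ _
    _ = (∏ l, (Finset.Icc (lo l) (hi l)).card) * d := by
        rw [Finset.card_product, Pi.card_Icc, Finset.card_univ, Fintype.card_fin]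
    _ ≤ (∏ _l : Fin d, (2 * M + 1)) * d := by
        refine Nat.mul_le_mul_right _ (Finset.prod_le_prod' fun l _ => ?_)
        rw [Int.card_Icc]
        have := h l
        omega
    _ = d * (2 * M + 1) ^ d := by
        rw [Finset.prod_const, Finset.card_univ, Fintype.card_fin, mul_comm]

/-! ### Open boxes and the good events. -/

/-- All bonds inside the box `[lo, hi]` have conductance at least `u`. -/
def BoxOpen {d : ℕ} (c : Edge d → ℝ) (u : ℝ) (lo hi : Fin d → ℤ) : Prop :=
  ∀ b ∈ boxBonds lo hi, u ≤ c b.edge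

/-- The sign `±1` of a direction. -/
def sgn (s : Bool) : ℤ := if s then 1 else -1

/-- The lower corner of the straight path of length `K` from `x` in direction `i`, sign `s`. -/
def rayLo {d : ℕ} (K : ℕ) (x : Fin d → ℤ) (i : Fin d) (s : Bool) : Fin d → ℤ :=
  x + Pi.single i (if s then 0 else -(K : ℤ))

/-- The upper corner of the straight path of length `K` from `x` in direction `i`, sign `s`. -/
def rayHi {d : ℕ} (K : ℕ) (x : Fin d → ℤ) (i : Fin d) (s : Bool) : Fin d → ℤ :=
  x + Pi.single i (if s then (K : ℤ) else 0)

/-- The lower corner of a slab of radius `K` in the hyperplane through `x + a e_{i₀}`. -/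
def slabLo {d : ℕ} (i₀ : Fin d) (K : ℕ) (x : Fin d → ℤ) (a : ℤ) : Fin d → ℤ :=
  fun l => if l = i₀ then x l + a else x l - K

/-- The upper corner of a slab of radius `K` in the hyperplane through `x + a e_{i₀}`. -/
def slabHi {d : ℕ} (i₀ : Fin d) (K : ℕ) (x : Fin d → ℤ) (a : ℤ) : Fin d → ℤ :=
  fun l => if l = i₀ then x l + a else x l + K

/-- Every site of the box is the start of an open straight path of length `K`. -/
def SiteGood {d : ℕ} (c : Edge d → ℝ) (u : ℝ) (K n : ℕ) : Prop :=
  ∀ x ∈ box d n, ∃ i s, BoxOpen c u (rayLo K x i s) (rayHi K x i s)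

/-- Every bond in the box has an endpoint at which an open straight path of length `K` starts. -/
def PairGood {d : ℕ} (c : Edge d → ℝ) (u : ℝ) (K n : ℕ) : Prop :=
  ∀ x ∈ box d n, ∀ j, ∃ e : Bool, ∃ i s,
    BoxOpen c u (rayLo K (if e then x + Pi.single j 1 else x) i s)
      (rayHi K (if e then x + Pi.single j 1 else x) i s)

/-- Every straight path of length `K` orthogonal to `i₀` crosses an open line in direction `i₀`. -/
def LineGood {d : ℕ} (c : Edge d → ℝ) (u : ℝ) (i₀ : Fin d) (K M n : ℕ) : Prop :=
  ∀ x ∈ box d n, ∀ i, i ≠ i₀ → ∀ s, ∃ t ∈ Finset.range K,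
    BoxOpen c u (x + Pi.single i (sgn s * t) + Pi.single i₀ (-(M : ℤ)))
      (x + Pi.single i (sgn s * t) + Pi.single i₀ (M : ℤ))

/-- Every straight path of length `K` in direction `i₀` crosses an open slab. -/
def SlabGood {d : ℕ} (c : Edge d → ℝ) (u : ℝ) (i₀ : Fin d) (K n : ℕ) : Prop :=
  ∀ x ∈ box d n, ∀ s, ∃ t ∈ Finset.range K,
    BoxOpen c u (slabLo i₀ K x (sgn s * t)) (slabHi i₀ K x (sgn s * t))

open scoped Classical in
/-- At least half of the points of each segment of length `m` are in the infinite cluster. -/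
def DensityGood {d : ℕ} (c : Edge d → ℝ) (ξ : ℝ) (i₀ : Fin d) (m n : ℕ) : Prop :=
  ∀ x ∈ box d n, m ≤ 2 *
    ((Finset.range m).filter fun t : ℕ => x + Pi.single i₀ (t : ℤ) ∈ cluster c ξ).card

theorem disjoint_ray {d : ℕ} {K : ℕ} {x : Fin d → ℤ} {i i' : Fin d} {s s' : Bool}
    (h : (i, s) ≠ (i', s')) : Disjoint (boxBonds (rayLo K x i s) (rayHi K x i s))
      (boxBonds (rayLo K x i' s') (rayHi K x i' s')) := by
  rw [Finset.disjoint_left]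
  intro b hb hb'
  have h1 := mem_boxBonds_dir hb
  have h2 := mem_boxBonds_dir hb'
  simp only [rayLo, rayHi, Pi.add_apply, Pi.single_apply] at h1 h2
  by_cases hi : b.2 = i
  · by_cases hi' : b.2 = i'
    · have : s ≠ s' := fun hs => h (by rw [← hi, ← hi', hs])
      simp only [hi, if_true] at h1 h2
      cases s <;> cases s' <;> simp_all <;> omega
    · simp only [hi', if_false] at h2; omega
  · simp only [hi, if_false] at h1; omega

/-- The ray from each endpoint towards the other is discarded, since both run over the joining bond.
The remaining `4d - 2` rays lie on different lines or point away from each other. -/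
theorem disjoint_ray_pair {d : ℕ} {K : ℕ} {x : Fin d → ℤ} {i i' j : Fin d} {s s' : Bool}
    (h : (i, s) ≠ (j, true)) (h' : (i', s') ≠ (j, false)) :
    Disjoint (boxBonds (rayLo K x i s) (rayHi K x i s))
      (boxBonds (rayLo K (x + Pi.single j 1) i' s') (rayHi K (x + Pi.single j 1) i' s')) := by
  rw [Finset.disjoint_left]
  intro b hb hb'
  have h1 := mem_boxBonds_dir hb
  have h2 := mem_boxBonds_dir hb'
  have h3 := mem_boxBonds_le hb j
  have h4 := mem_boxBonds_le hb' j
  simp only [rayLo, rayHi, Pi.add_apply, Pi.single_apply] at h1 h2 h3 h4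
  by_cases hi : b.2 = i
  · by_cases hi' : b.2 = i'
    · by_cases hj : j = i
      · have hs : s = false := by
          cases s
          · rfl
          · exact absurd (by rw [hj]) h
        have hs' : s' = true := by
          cases s'
          · exact absurd (by rw [hj, ← hi, hi']) h'
          · rfl
        have hji' : j = i' := by rw [hj, ← hi, hi']
        subst hs hs'
        simp only [hj, ← hi] at h3 h4
        simp [hi'] at h3 h4
        omega
      · have hj' : j ≠ i' := fun h => hj (by rw [h, ← hi', hi])
        simp only [hj, hj', if_false, if_true] at h3 h4
        omega
    · simp only [hi', if_false] at h2; omega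
  · simp only [hi, if_false] at h1; omega

/-! ### Union bounds -/

section Bounds

variable {Ω : Type u} [MeasurableSpace Ω] {P : Measure Ω}

/-- Each `k ∈ s` chooses one of the sets `S k a`, and the bad events occur on all of it. -/
theorem measure_forall_exists_le [IsProbabilityMeasure P] {β κ ι : Type*} {A : β → Set Ω}
    {q : ENNReal}
    (hA : ∀ F : Finset β, P {w | ∀ b ∈ F, w ∈ A b} ≤ q ^ F.card) (s : Finset κ)
    (I : κ → Finset ι) (S : κ → ι → Finset β)
    (hd : ∀ k ∈ s, ∀ k' ∈ s, k ≠ k' → ∀ a ∈ I k, ∀ a' ∈ I k', Disjoint (S k a) (S k' a')) :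
    P {w | ∀ k ∈ s, ∃ a ∈ I k, ∀ b ∈ S k a, w ∈ A b}
      ≤ ∏ k ∈ s, ∑ a ∈ I k, q ^ (S k a).card := by
  classical
  -- `G` collects the elements already forced to be bad by earlier choices. Disjointness makes the
  -- exponents add, so the product bound `hA` on finite sets is all that is needed.
  suffices H : ∀ G : Finset β, (∀ k ∈ s, ∀ a ∈ I k, Disjoint G (S k a)) →
      P {w | (∀ b ∈ G, w ∈ A b) ∧ ∀ k ∈ s, ∃ a ∈ I k, ∀ b ∈ S k a, w ∈ A b}
        ≤ q ^ G.card * ∏ k ∈ s, ∑ a ∈ I k, q ^ (S k a).card by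
    simpa using H ∅ fun _ _ _ _ => Finset.disjoint_empty_left _
  induction s using Finset.induction_on with
  | empty => intro G _; simpa using hA G
  | insert k₀ s hk₀ ih =>
    intro G hG
    calc _ ≤ P (⋃ a ∈ I k₀, {w | (∀ b ∈ G ∪ S k₀ a, w ∈ A b) ∧
            ∀ k ∈ s, ∃ a ∈ I k, ∀ b ∈ S k a, w ∈ A b}) := by
          refine measure_mono fun w hw => ?_
          obtain ⟨a, ha, haw⟩ := hw.2 k₀ (Finset.mem_insert_self _ _)
          simp only [Set.mem_iUnion]
          refine ⟨a, ha, fun b hb => ?_, fun k hk => hw.2 k (Finset.mem_insert_of_mem hk)⟩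
          exact (Finset.mem_union.1 hb).elim (hw.1 b) (haw b)
      _ ≤ ∑ a ∈ I k₀, P {w | (∀ b ∈ G ∪ S k₀ a, w ∈ A b) ∧
            ∀ k ∈ s, ∃ a ∈ I k, ∀ b ∈ S k a, w ∈ A b} := measure_biUnion_finset_le _ _
      _ ≤ ∑ a ∈ I k₀, q ^ (G ∪ S k₀ a).card * ∏ k ∈ s, ∑ a ∈ I k, q ^ (S k a).card := by
          refine Finset.sum_le_sum fun a ha => ih (fun k hk k' hk' => hd k
            (Finset.mem_insert_of_mem hk) k' (Finset.mem_insert_of_mem hk')) _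
            fun k hk a' ha' => Finset.disjoint_union_left.2
              ⟨hG k (Finset.mem_insert_of_mem hk) a' ha', ?_⟩
          exact hd k₀ (Finset.mem_insert_self _ _) k (Finset.mem_insert_of_mem hk)
            (fun h => hk₀ (h ▸ hk)) a ha a' ha'
      _ = _ := by
          rw [Finset.prod_insert hk₀, ← mul_assoc, Finset.mul_sum, Finset.sum_mul]
          refine Finset.sum_congr rfl fun a ha => ?_
          rw [Finset.card_union_of_disjoint (hG k₀ (Finset.mem_insert_self _ _) a ha), pow_add]

theorem measure_forall_exists_mem_le [IsProbabilityMeasure P] {β κ : Type*} {A : β → Set Ω}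
    {q : ENNReal}
    (hA : ∀ F : Finset β, P {w | ∀ b ∈ F, w ∈ A b} ≤ q ^ F.card) (s : Finset κ)
    (F : κ → Finset β) (hd : ∀ k ∈ s, ∀ k' ∈ s, k ≠ k' → Disjoint (F k) (F k')) {V : ℕ}
    (hV : ∀ k ∈ s, (F k).card ≤ V) :
    P {w | ∀ k ∈ s, ∃ b ∈ F k, w ∈ A b} ≤ (V * q) ^ s.card := by
  have := measure_forall_exists_le hA s F (fun _ b => {b}) (by
      intro k hk k' hk' hkk' b hb b' hb'
      rw [Finset.disjoint_singleton]
      rintro rfl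
      exact Finset.disjoint_left.1 (hd k hk k' hk' hkk') hb hb')
  simp only [Finset.mem_singleton, forall_eq, Finset.card_singleton, pow_one,
    Finset.sum_const, nsmul_eq_mul] at this
  refine this.trans ?_
  rw [← Finset.prod_const]
  exact Finset.prod_le_prod' fun k hk => by gcongr; exact hV k hk

theorem measure_exists_mem_le {κ : Type*} (s : Finset κ) (E : κ → Set Ω) {r : ENNReal}
    (h : ∀ k ∈ s, P (E k) ≤ r) : P {w | ∃ k ∈ s, w ∈ E k} ≤ s.card * r := by
  have : {w | ∃ k ∈ s, w ∈ E k} = ⋃ k ∈ s, E k := by ext; simp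
  rw [this]
  refine (measure_biUnion_finset_le _ _).trans ?_
  rw [← nsmul_eq_mul]
  exact Finset.sum_le_card_nsmul _ _ _ h

variable {d : ℕ} {ω : Edge d → Ω → ℝ}

/-- The bounds `P (all bonds of F have conductance less than u) ≤ q ^ |F|`. -/
def BondBound (P : Measure Ω) (ω : Edge d → Ω → ℝ) (u : ℝ) (q : ENNReal) : Prop :=
  ∀ F : Finset (Bond d), P {w | ∀ b ∈ F, w ∈ {w | ω b.edge w < u}} ≤ q ^ F.card

/-- The union bounds see the environment only through this product estimate. Injectivity of
`Bond.edge` ensures that distinct bonds carry independent conductances. -/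
theorem IsPolyTailEnvironment.bondBound {γ : ℝ} (h : IsPolyTailEnvironment P γ ω) (e : Edge d)
    (u : ℝ) : BondBound P ω u (P {w | ω e w < u}) := by
  intro F
  have hind := h.indep.precomp (Bond.edge_injective (d := d))
  have := hind.measure_inter_preimage_eq_mul F (sets := fun _ => Set.Iio u)
    fun _ _ => measurableSet_Iio
  have hset : {w | ∀ b ∈ F, w ∈ {w | ω b.edge w < u}}
      = ⋂ b ∈ F, (fun w => ω (Bond.edge b) w) ⁻¹' Set.Iio u := by ext; simp
  rw [hset]
  refine this.le.trans ?_
  rw [← Finset.prod_const]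
  refine Finset.prod_le_prod' fun b _ => le_of_eq ?_
  exact (h.identDistrib b.edge e).measure_mem_eq measurableSet_Iio

variable [IsProbabilityMeasure P] {u : ℝ} {q : ENNReal}

theorem measure_forall_not_boxOpen_le (hq : BondBound P ω u q) {κ : Type*} (s : Finset κ)
    (lo hi : κ → Fin d → ℤ) {M : ℕ} (hM : ∀ k ∈ s, ∀ l, hi k l ≤ lo k l + 2 * M)
    (hd : ∀ k ∈ s, ∀ k' ∈ s, k ≠ k' → Disjoint (boxBonds (lo k) (hi k))
      (boxBonds (lo k') (hi k'))) :
    P {w | ∀ k ∈ s, ¬ BoxOpen (fun e => ω e w) u (lo k) (hi k)}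
      ≤ ((d * (2 * M + 1) ^ d : ℕ) * q) ^ s.card := by
  refine (measure_mono fun w hw => ?_).trans (measure_forall_exists_mem_le hq s
    (fun k => boxBonds (lo k) (hi k)) hd fun k hk => card_boxBonds_le (hM k hk))
  intro k hk
  have := hw k hk
  simp only [BoxOpen] at this
  push Not at this
  exact this

theorem measure_not_siteGood_le (hq : BondBound P ω u q) {K M : ℕ} (hKM : K ≤ M) (n : ℕ) :
    P {w | ¬ SiteGood (fun e => ω e w) u K n}
      ≤ (box d n).card * ((d * (2 * M + 1) ^ d : ℕ) * q) ^ (2 * d) := by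
  refine (measure_mono fun w hw => ?_).trans (measure_exists_mem_le (box d n)
    (fun x => {w | ∀ k ∈ (Finset.univ : Finset (Fin d × Bool)),
      ¬ BoxOpen (fun e => ω e w) u (rayLo K x k.1 k.2) (rayHi K x k.1 k.2)}) fun x hx => ?_)
  · simp only [SiteGood, Set.mem_ofPred_eq] at hw ⊢
    push Not at hw
    obtain ⟨x, hx, h⟩ := hw
    exact ⟨x, hx, fun k _ => h _ _⟩
  · refine (measure_forall_not_boxOpen_le hq _ _ _ (M := M) ?_ fun k _ k' _ hk =>
      disjoint_ray hk).trans (le_of_eq ?_)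
    · intro k _ l
      simp only [rayLo, rayHi, Pi.add_apply, Pi.single_apply]
      split_ifs <;> omega
    · simp [mul_comm]

/-- The exponent counts disjoint rays: `2 * 2d` from the two endpoints, less the two along the
joining bond. It produces the threshold `d / (8d - 4)`. -/
theorem measure_not_pairGood_le (hq : BondBound P ω u q) {K M : ℕ} (hKM : K ≤ M) (n : ℕ) :
    P {w | ¬ PairGood (fun e => ω e w) u K n}
      ≤ ((box d n).card * d : ℕ) * ((d * (2 * M + 1) ^ d : ℕ) * q) ^ (4 * d - 2) := by
  classical
  refine (measure_mono fun w hw => ?_).trans ((measure_exists_mem_le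
    (box d n ×ˢ (Finset.univ : Finset (Fin d)))
    (fun x => {w | ∀ k ∈ (Finset.univ : Finset (Bool × Fin d × Bool)) \
        {(false, x.2, true), (true, x.2, false)},
      ¬ BoxOpen (fun e => ω e w) u
        (rayLo K (if k.1 then x.1 + Pi.single x.2 1 else x.1) k.2.1 k.2.2)
        (rayHi K (if k.1 then x.1 + Pi.single x.2 1 else x.1) k.2.1 k.2.2)})
    (r := ((d * (2 * M + 1) ^ d : ℕ) * q) ^ (4 * d - 2)) fun x hx => ?_).trans (le_of_eq ?_))
  · simp only [PairGood, Set.mem_ofPred_eq] at hw ⊢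
    push Not at hw
    obtain ⟨x, hx, j, h⟩ := hw
    exact ⟨(x, j), by simpa using hx, fun k _ => h _ _ _⟩
  · refine (measure_forall_not_boxOpen_le hq _ _ _ (M := M) ?_ ?_).trans (le_of_eq ?_)
    · intro k _ l
      simp only [rayLo, rayHi, Pi.add_apply, Pi.single_apply]
      split_ifs <;> omega
    · rintro ⟨e, i, s⟩ hk ⟨e', i', s'⟩ hk' hkk'
      simp only [Finset.mem_sdiff, Finset.mem_univ, true_and, Finset.mem_insert,
        Finset.mem_singleton, not_or, Prod.mk.injEq, not_and] at hk hk'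
      cases e <;> cases e'
      · exact disjoint_ray fun h => hkk' (by rw [h])
      · exact disjoint_ray_pair (by simpa using hk.1) (by simpa using hk'.2)
      · exact (disjoint_ray_pair (by simpa using hk'.1) (by simpa using hk.2)).symm
      · exact disjoint_ray fun h => hkk' (by rw [h])
    · congr 1
      rw [Finset.card_sdiff_of_subset (Finset.subset_univ _), Finset.card_univ,
        Finset.card_pair (by simp)]
      simp
      omega
  · rw [Finset.card_product, Finset.card_univ, Fintype.card_fin]

/-- The `K` lines met by the path are translates of one another and share no bond. The exponent `K`
is a free parameter, so this event never constrains `γ`; the same holds for slabs. -/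
theorem measure_not_lineGood_le (hq : BondBound P ω u q) (i₀ : Fin d) (K M n : ℕ) :
    P {w | ¬ LineGood (fun e => ω e w) u i₀ K M n}
      ≤ ((box d n).card * (d * 2) : ℕ) * ((d * (2 * M + 1) ^ d : ℕ) * q) ^ K := by
  refine (measure_mono fun w hw => ?_).trans ((measure_exists_mem_le
    (box d n ×ˢ (Finset.univ.filter fun k : Fin d × Bool => k.1 ≠ i₀))
    (fun x => {w | ∀ t ∈ Finset.range K, ¬ BoxOpen (fun e => ω e w) u
      (x.1 + Pi.single x.2.1 (sgn x.2.2 * t) + Pi.single i₀ (-(M : ℤ)))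
      (x.1 + Pi.single x.2.1 (sgn x.2.2 * t) + Pi.single i₀ (M : ℤ))})
    (r := ((d * (2 * M + 1) ^ d : ℕ) * q) ^ K) fun x hx => ?_).trans ?_)
  · simp only [LineGood, Set.mem_ofPred_eq] at hw ⊢
    push Not at hw
    obtain ⟨x, hx, i, hi, s, h⟩ := hw
    exact ⟨(x, i, s), by simpa using ⟨hx, hi⟩, h⟩
  · have hi : x.2.1 ≠ i₀ := by simpa using (Finset.mem_product.1 hx).2
    refine (measure_forall_not_boxOpen_le hq _ _ _ (M := M) ?_ ?_).trans (by
      rw [Finset.card_range])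
    · intro k _ l
      simp only [Pi.add_apply, Pi.single_apply]
      split_ifs <;> omega
    · intro k _ k' _ hkk'
      rw [Finset.disjoint_left]
      intro b hb hb'
      have h1 := mem_boxBonds_le hb x.2.1
      have h2 := mem_boxBonds_le hb' x.2.1
      simp [hi, sgn] at h1 h2
      split_ifs at h1 h2 <;> omega
  · gcongr
    rw [Finset.card_product]
    refine Nat.mul_le_mul_left _ ((Finset.card_filter_le _ _).trans ?_)
    simp

theorem measure_not_slabGood_le (hq : BondBound P ω u q) (i₀ : Fin d) {K M : ℕ} (hKM : K ≤ M)
    (n : ℕ) :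
    P {w | ¬ SlabGood (fun e => ω e w) u i₀ K n}
      ≤ ((box d n).card * 2 : ℕ) * ((d * (2 * M + 1) ^ d : ℕ) * q) ^ K := by
  refine (measure_mono fun w hw => ?_).trans ((measure_exists_mem_le
    (box d n ×ˢ (Finset.univ : Finset Bool))
    (fun x => {w | ∀ t ∈ Finset.range K, ¬ BoxOpen (fun e => ω e w) u
      (slabLo i₀ K x.1 (sgn x.2 * t)) (slabHi i₀ K x.1 (sgn x.2 * t))})
    (r := ((d * (2 * M + 1) ^ d : ℕ) * q) ^ K) fun x hx => ?_).trans (le_of_eq ?_))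
  · simp only [SlabGood, Set.mem_ofPred_eq] at hw ⊢
    push Not at hw
    obtain ⟨x, hx, s, h⟩ := hw
    exact ⟨(x, s), by simpa using hx, h⟩
  · refine (measure_forall_not_boxOpen_le hq _ _ _ (M := M) ?_ ?_).trans (by
      rw [Finset.card_range])
    · intro k _ l
      simp only [slabLo, slabHi]
      split_ifs <;> omega
    · intro k _ k' _ hkk'
      rw [Finset.disjoint_left]
      intro b hb hb'
      have h1 := mem_boxBonds_le hb i₀
      have h2 := mem_boxBonds_le hb' i₀
      simp [slabLo, slabHi, sgn] at h1 h2
      split_ifs at h1 h2 <;> omega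
  · rw [Finset.card_product, Finset.card_univ, Fintype.card_bool]

end Bounds

/-! ### Density of the infinite cluster -/

/-- The embedding of the plane spanned by `i₀, i₁` with origin `x`. -/
def planePoint {d : ℕ} (i₀ i₁ : Fin d) (x : Fin d → ℤ) (p : ℤ × ℤ) : Fin d → ℤ :=
  x + Pi.single i₀ p.1 + Pi.single i₁ p.2

/-- The embedding of planar bonds corresponding to `planePoint`. -/
def planeBond {d : ℕ} (i₀ i₁ : Fin d) (x : Fin d → ℤ) (b : PlaneBond) : Bond d :=
  (planePoint i₀ i₁ x b.1, if b.2 then i₁ else i₀)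

theorem planePoint_injective {d : ℕ} {i₀ i₁ : Fin d} (h : i₀ ≠ i₁) (x : Fin d → ℤ) :
    Function.Injective (planePoint i₀ i₁ x) := by
  intro p q hpq
  have h0 := congrFun hpq i₀
  have h1 := congrFun hpq i₁
  simp [planePoint, h, h.symm] at h0 h1
  exact Prod.ext h0 h1

theorem planeBond_injective {d : ℕ} {i₀ i₁ : Fin d} (h : i₀ ≠ i₁) (x : Fin d → ℤ) :
    Function.Injective (planeBond i₀ i₁ x) := by
  rintro ⟨p, o⟩ ⟨q, o'⟩ hpq
  have h1 := planePoint_injective h x (congrArg Prod.fst hpq)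
  have h2 := congrArg Prod.snd hpq
  simp only [planeBond] at h1 h2
  subst h1
  cases o <;> cases o' <;> simp_all [h.symm]

theorem planePoint_tip {d : ℕ} (i₀ i₁ : Fin d) (x : Fin d → ℤ) (b : PlaneBond) :
    planePoint i₀ i₁ x b.tip
      = (planeBond i₀ i₁ x b).1 + Pi.single (planeBond i₀ i₁ x b).2 1 := by
  rcases b with ⟨⟨a, b⟩, _ | _⟩ <;>
    simp only [planePoint, planeBond, PlaneBond.tip, Pi.single_add, if_true, if_false,
      Bool.false_eq_true] <;> abel

theorem openGraph_adj_of_le {d : ℕ} {c : Edge d → ℝ} {u : ℝ} {b : Bond d} (h : u ≤ c b.edge) :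
    (openGraph c u).Adj b.1 (b.1 + Pi.single b.2 1) :=
  ⟨lattice_adj_add_single _ _, h⟩

/-- A closed contour of length `j` in the plane through `x`. -/
def HasContour {d : ℕ} (c : Edge d → ℝ) (ξ : ℝ) (i₀ i₁ : Fin d) (x : Fin d → ℤ) (j : ℕ) : Prop :=
  ∃ F ∈ (starSets j ((j, 0), false)).filter (fun F => F.card = j + 1),
    ∀ e ∈ F, c (planeBond i₀ i₁ x e).edge < ξ

/-- The planar cluster of the origin embeds injectively into the finite lattice cluster of `x`, so
it is finite and has a contour. -/
theorem exists_hasContour {d : ℕ} {c : Edge d → ℝ} {ξ : ℝ} {i₀ i₁ : Fin d} (h : i₀ ≠ i₁)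
    {x : Fin d → ℤ} (hx : x ∉ cluster c ξ) : ∃ j, HasContour c ξ i₀ i₁ x j := by
  have hfin : {y | (openGraph c ξ).Reachable x y}.Finite := by
    simpa [cluster, Set.not_infinite] using hx
  obtain ⟨j, F, hF, hcard, hFO⟩ :=
    exists_contour (O := {e | ξ ≤ c (planeBond i₀ i₁ x e).edge}) <| by
      refine (hfin.preimage (planePoint_injective h x).injOn).subset fun p hp => ?_
      have hinv := eq_of_planeGraph_reachable
        (g := fun p => (openGraph c ξ).Reachable x (planePoint i₀ i₁ x p)) (fun b hb => by
          have hadj := openGraph_adj_of_le (c := c) hb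
          rw [← planePoint_tip] at hadj
          exact propext ⟨fun h => h.trans hadj.symm.reachable, fun h => h.trans hadj.reachable⟩) hp
      have h0 : planePoint i₀ i₁ x (0, 0) = x := by simp [planePoint]
      simp only [h0] at hinv
      exact hinv.mp (SimpleGraph.Reachable.refl _)
  exact ⟨j, F, Finset.mem_filter.2 ⟨hF, hcard⟩, fun e he => not_le.1 (hFO e he)⟩

section Bounds

variable {Ω : Type u} [MeasurableSpace Ω] {P : Measure Ω} [IsProbabilityMeasure P] {d : ℕ}
  {ω : Edge d → Ω → ℝ} {ξ : ℝ} {q : ENNReal}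

theorem card_image_planeBond {i₀ i₁ : Fin d} (h : i₀ ≠ i₁) (x : Fin d → ℤ)
    (F : Finset PlaneBond) : (F.image (planeBond i₀ i₁ x)).card = F.card :=
  Finset.card_image_of_injective _ (planeBond_injective h x)

/-- There are at most `18 ^ j` candidates and `18 / 64 < 1 / 2`. The one bond beyond `j` supplies
the factor `1 / 64`. -/
theorem sum_starSets_le (hq : q ≤ 1 / 64) (j : ℕ) :
    ∑ F ∈ (starSets j ((j, 0), false)).filter (fun F => F.card = j + 1), q ^ F.card
      ≤ 2⁻¹ ^ j * (1 / 64) := by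
  calc _ = ∑ F ∈ (starSets j ((j, 0), false)).filter (fun F => F.card = j + 1), q ^ (j + 1) :=
        Finset.sum_congr rfl fun F hF => by rw [(Finset.mem_filter.1 hF).2]
    _ ≤ (18 ^ j : ℕ) * q ^ (j + 1) := by
        rw [Finset.sum_const, nsmul_eq_mul]
        gcongr
        exact (Finset.card_filter_le _ _).trans (card_starSets_le _ _)
    _ = (18 * q) ^ j * q := by push_cast; rw [mul_pow, pow_succ, mul_assoc]
    _ ≤ 2⁻¹ ^ j * (1 / 64) := by
        gcongr
        calc 18 * q ≤ 18 * (1 / 64) := by gcongr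
          _ ≤ 2⁻¹ := by
            rw [← ENNReal.toReal_le_toReal (by finiteness) (by finiteness)]
            norm_num

theorem measure_exists_hasContour_ge_le (hq : BondBound P ω ξ q) (hq64 : q ≤ 1 / 64)
    {i₀ i₁ : Fin d} (h : i₀ ≠ i₁) (x : Fin d → ℤ) (r : ℕ) :
    P {w | ∃ j, r ≤ j ∧ HasContour (fun e => ω e w) ξ i₀ i₁ x j} ≤ 2⁻¹ ^ r := by
  have hone : ∀ j, P {w | HasContour (fun e => ω e w) ξ i₀ i₁ x j} ≤ 2⁻¹ ^ j * (1 / 64) := by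
    intro j
    have := measure_forall_exists_le hq {()}
      (fun _ => (starSets j ((j, 0), false)).filter (fun F => F.card = j + 1))
      (fun _ F => F.image (planeBond i₀ i₁ x)) (fun k _ k' _ hkk' => absurd rfl hkk')
    simp only [Finset.mem_singleton, Finset.prod_singleton, card_image_planeBond h] at this
    refine (measure_mono fun w hw => ?_).trans (this.trans (sum_starSets_le hq64 j))
    obtain ⟨F, hF, hFw⟩ := hw
    exact fun _ _ => ⟨F, hF, fun b hb => by
      obtain ⟨e, he, rfl⟩ := Finset.mem_image.1 hb
      exact hFw e he⟩
  calc _ ≤ P (⋃ i : ℕ, {w | HasContour (fun e => ω e w) ξ i₀ i₁ x (r + i)}) := by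
        refine measure_mono fun w hw => ?_
        obtain ⟨j, hj, hw⟩ := hw
        exact Set.mem_iUnion.2 ⟨j - r, by simpa [Nat.add_sub_cancel' hj] using hw⟩
    _ ≤ ∑' i : ℕ, P {w | HasContour (fun e => ω e w) ξ i₀ i₁ x (r + i)} := measure_iUnion_le _
    _ ≤ ∑' i : ℕ, 2⁻¹ ^ r * (1 / 64) * 2⁻¹ ^ i := by
        refine ENNReal.tsum_le_tsum fun i => (hone _).trans (le_of_eq ?_)
        rw [pow_add]; ring
    _ = 2⁻¹ ^ r * (1 / 64 * 2) := by
        rw [ENNReal.tsum_mul_left, ENNReal.tsum_geometric, ENNReal.one_sub_inv_two, inv_inv,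
          mul_assoc]
    _ ≤ 2⁻¹ ^ r * 1 := by
        gcongr
        rw [← ENNReal.toReal_le_toReal (by finiteness) (by finiteness)]
        norm_num
    _ = _ := mul_one _

/-- A contour of length `j < r` starts `j` columns to the right of its centre and stays within `j`
of its start, so it occupies columns `0` to `2j` relative to the centre. Centres more than `2r`
apart thus use disjoint bonds. Each centre contributes at most `2 / 64`, which is below `1 / 16`. -/
theorem measure_forall_hasContour_lt_le (hq : BondBound P ω ξ q) (hq64 : q ≤ 1 / 64)
    {i₀ i₁ : Fin d} (h : i₀ ≠ i₁) (x : Fin d → ℤ) (r : ℕ) (T : Finset ℕ)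
    (hT : ∀ t ∈ T, ∀ t' ∈ T, t < t' → t + 2 * r < t') :
    P {w | ∀ t ∈ T, ∃ j < r,
        HasContour (fun e => ω e w) ξ i₀ i₁ (x + Pi.single i₀ (t : ℤ)) j} ≤ 16⁻¹ ^ T.card := by
  have := measure_forall_exists_le hq T
    (fun _ => (Finset.range r).sigma fun j =>
      (starSets j ((j, 0), false)).filter (fun F => F.card = j + 1))
    (fun t F => F.2.image (planeBond i₀ i₁ (x + Pi.single i₀ (t : ℤ)))) (by
      intro t ht t' ht' htt' F hF F' hF'
      rw [Finset.disjoint_left]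
      intro b hb hb'
      simp only [Finset.mem_image] at hb hb'
      obtain ⟨e, he, rfl⟩ := hb
      obtain ⟨e', he', hee'⟩ := hb'
      simp only [Finset.mem_sigma, Finset.mem_range, Finset.mem_filter] at hF hF'
      have h1 := (dist_le_of_mem_starSets hF.2.1 he).1
      have h2 := (dist_le_of_mem_starSets hF'.2.1 he').1
      have h3 := congrFun (congrArg Prod.fst hee') i₀
      simp [planeBond, planePoint, h] at h3
      rw [abs_le] at h1 h2
      simp only at h1 h2
      rcases lt_or_gt_of_ne htt' with hlt | hlt
      · have := hT t ht t' ht' hlt; omega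
      · have := hT t' ht' t ht hlt; omega)
  refine (measure_mono fun w hw t ht => ?_).trans (this.trans ?_)
  · obtain ⟨j, hj, F, hF, hFw⟩ := hw t ht
    exact ⟨⟨j, F⟩, Finset.mem_sigma.2 ⟨Finset.mem_range.2 hj, hF⟩, fun b hb => by
      obtain ⟨e, he, rfl⟩ := Finset.mem_image.1 hb
      exact hFw e he⟩
  · rw [← Finset.prod_const]
    refine Finset.prod_le_prod' fun t _ => ?_
    simp only [card_image_planeBond h, Finset.sum_sigma]
    calc _ ≤ ∑ j ∈ Finset.range r, (2⁻¹ : ENNReal) ^ j * (1 / 64) :=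
          Finset.sum_le_sum fun j _ => sum_starSets_le hq64 j
      _ ≤ ∑' j : ℕ, (2⁻¹ : ENNReal) ^ j * (1 / 64) := ENNReal.sum_le_tsum _
      _ = 2 * (1 / 64) := by
          rw [ENNReal.tsum_mul_right, ENNReal.tsum_geometric, ENNReal.one_sub_inv_two, inv_inv]
      _ ≤ 16⁻¹ := by
          rw [← ENNReal.toReal_le_toReal (by finiteness) (by finiteness)]
          norm_num

/-- Averaging over residue classes: a set of density one half has density one half in some class,
whose points are well separated. -/
theorem exists_dense_class {Z : ℕ → Prop} [DecidablePred Z] {s r : ℕ} (hs : 0 < s)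
    (hZ : s * r ≤ 2 * ((Finset.range (s * r)).filter Z).card) :
    ∃ a ∈ Finset.range s, r ≤ 2 * ((Finset.range r).filter fun b => Z (a + s * b)).card := by
  by_contra! hcon
  have h1 : ((Finset.range (s * r)).filter Z).card
      ≤ ∑ a ∈ Finset.range s, ((Finset.range r).filter fun b => Z (a + s * b)).card := by
    refine le_trans ?_ ((Finset.card_biUnion_le (s := Finset.range s) (t := fun a =>
      ((Finset.range r).filter fun b => Z (a + s * b)).image fun b => a + s * b)).trans
        (Finset.sum_le_sum fun a _ => Finset.card_image_le))
    refine Finset.card_le_card fun t ht => ?_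
    simp only [Finset.mem_filter, Finset.mem_range] at ht
    simp only [Finset.mem_biUnion, Finset.mem_image, Finset.mem_filter, Finset.mem_range]
    have hdm : t % s + s * (t / s) = t := Nat.mod_add_div t s
    exact ⟨t % s, Nat.mod_lt _ hs, t / s,
      ⟨Nat.div_lt_of_lt_mul ht.1, by rw [hdm]; exact ht.2⟩, hdm⟩
  have h2 : ∑ a ∈ Finset.range s, 2 * ((Finset.range r).filter fun b => Z (a + s * b)).card
      < ∑ _a ∈ Finset.range s, r :=
    Finset.sum_lt_sum_of_nonempty ⟨0, Finset.mem_range.2 hs⟩ hcon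
  rw [← Finset.mul_sum, Finset.sum_const, Finset.card_range, smul_eq_mul] at h2
  omega

theorem add_single_mem_box {d n m : ℕ} {i : Fin d} {x : Fin d → ℤ} {t : ℤ} (hx : x ∈ box d n)
    (ht : |t| ≤ m) : x + Pi.single i t ∈ box d (n + m) := by
  simp only [box, Finset.mem_Icc, Pi.le_def] at hx ⊢
  rw [abs_le] at ht
  constructor <;> intro l <;> have h1 := hx.1 l <;> have h2 := hx.2 l <;>
    simp only [Pi.add_apply, Pi.single_apply] <;> push_cast <;> split_ifs <;> omega

theorem card_box (d n : ℕ) : (box d n).card = (2 * n + 1) ^ d := by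
  rw [box, Pi.card_Icc, Finset.prod_congr rfl (g := fun _ => 2 * n + 1), Finset.prod_const,
    Finset.card_univ, Fintype.card_fin]
  intro i _
  rw [Int.card_Icc]
  omega

theorem box_subset {d n n' : ℕ} (h : n ≤ n') : box d n ⊆ box d n' :=
  Finset.Icc_subset_Icc (fun _ => by simpa using h) (fun _ => by simpa using h)

/-- If density fails, either some contour has length at least `r`, or some residue class modulo `2r
+ 1` contains at least `r / 2` sites surrounded by short contours with disjoint supports. The second
case costs `16 ^ (-r/2) = 4 ^ (-r)` for each of at most `2 ^ r` subsets. -/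
theorem measure_not_densityGood_le (hq : BondBound P ω ξ q) (hq64 : q ≤ 1 / 64)
    {i₀ i₁ : Fin d} (h : i₀ ≠ i₁) (r n : ℕ) :
    P {w | ¬ DensityGood (fun e => ω e w) ξ i₀ ((2 * r + 1) * r) n}
      ≤ ((box d (n + (2 * r + 1) * r)).card * (2 * r + 2) : ℕ) * 2⁻¹ ^ r := by
  classical
  set m := (2 * r + 1) * r with hm
  set B := box d (n + m) with hB
  let E₁ : (Fin d → ℤ) → Set Ω := fun x =>
    {w | ∃ j, r ≤ j ∧ HasContour (fun e => ω e w) ξ i₀ i₁ x j}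
  let E₂ : ((Fin d → ℤ) × ℕ) × Finset ℕ → Set Ω := fun k =>
    {w | ∀ t ∈ k.2.image fun b => k.1.2 + (2 * r + 1) * b, ∃ j < r,
      HasContour (fun e => ω e w) ξ i₀ i₁ (k.1.1 + Pi.single i₀ (t : ℤ)) j}
  let I₂ : Finset (((Fin d → ℤ) × ℕ) × Finset ℕ) :=
    (B ×ˢ Finset.range (2 * r + 1)) ×ˢ
      (Finset.range r).powerset.filter fun T => r ≤ 2 * T.card
  have hE₁ := measure_exists_mem_le (P := P) B E₁ fun x _ =>
    measure_exists_hasContour_ge_le hq hq64 h x r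
  have hE₂ : P {w | ∃ k ∈ I₂, w ∈ E₂ k} ≤ I₂.card * 4⁻¹ ^ r := by
    refine measure_exists_mem_le _ _ fun k hk => ?_
    simp only [I₂, Finset.mem_product, Finset.mem_filter, Finset.mem_powerset] at hk
    refine (measure_forall_hasContour_lt_le hq hq64 h k.1.1 r _ ?_).trans ?_
    · intro t ht t' ht' htt'
      simp only [Finset.mem_image] at ht ht'
      obtain ⟨b, -, rfl⟩ := ht
      obtain ⟨b', -, rfl⟩ := ht'
      have hbb : b < b' := by
        by_contra! hcon
        have := Nat.mul_le_mul_left (2 * r + 1) hcon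
        omega
      have := Nat.mul_le_mul_left (2 * r + 1) (Nat.succ_le_of_lt hbb)
      rw [Nat.mul_succ] at this
      omega
    · rw [Finset.card_image_of_injective _ fun a b hab => by simpa using hab]
      calc (16⁻¹ : ENNReal) ^ k.2.card = 4⁻¹ ^ (2 * k.2.card) := by
            rw [pow_mul]
            congr 1
            rw [← ENNReal.toReal_eq_toReal_iff' (by finiteness) (by finiteness)]
            norm_num
        _ ≤ 4⁻¹ ^ r := pow_le_pow_right_of_le_one' (by
            rw [← ENNReal.toReal_le_toReal (by finiteness) (by finiteness)]; norm_num) hk.2.2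
  have hI₂ : I₂.card ≤ B.card * (2 * r + 1) * 2 ^ r := by
    simp only [I₂, Finset.card_product, Finset.card_range]
    refine Nat.mul_le_mul_left _ ((Finset.card_filter_le _ _).trans ?_)
    rw [Finset.card_powerset, Finset.card_range]
  have hcover : {w | ¬ DensityGood (fun e => ω e w) ξ i₀ m n}
      ⊆ {w | ∃ x ∈ B, w ∈ E₁ x} ∪ {w | ∃ k ∈ I₂, w ∈ E₂ k} := by
    intro w hw
    by_contra hcon
    simp only [Set.mem_union, not_or] at hcon
    refine hw fun x hx => ?_
    by_contra! hlt
    have hcompl := Finset.card_filter_add_card_filter_not (s := Finset.range m)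
      fun t : ℕ => x + Pi.single i₀ (t : ℤ) ∈ cluster (fun e => ω e w) ξ
    rw [Finset.card_range] at hcompl
    have hdense : m ≤ 2 * ((Finset.range m).filter fun t : ℕ =>
        x + Pi.single i₀ (t : ℤ) ∉ cluster (fun e => ω e w) ξ).card := by omega
    obtain ⟨a, ha, hT⟩ := exists_dense_class (by omega) hdense
    refine hcon.2 ⟨((x, a), _), Finset.mem_product.2 ⟨Finset.mem_product.2
      ⟨box_subset (by omega) hx, ha⟩, Finset.mem_filter.2
        ⟨Finset.mem_powerset.2 (Finset.filter_subset _ _), hT⟩⟩, ?_⟩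
    intro t ht
    obtain ⟨b, hbT, rfl⟩ := Finset.mem_image.1 ht
    have hb := Finset.mem_range.1 (Finset.mem_filter.1 hbT).1
    obtain ⟨j, hj⟩ := exists_hasContour h (Finset.mem_filter.1 hbT).2
    -- A contour of length at least `r` at this site is excluded by the first event, taken in the
    -- box enlarged by `m`.
    refine ⟨j, ?_, hj⟩
    by_contra! hrj
    refine hcon.1 ⟨_, add_single_mem_box (i := i₀) (t := ((a + (2 * r + 1) * b : ℕ) : ℤ)) hx ?_,
      j, hrj, hj⟩
    have := Finset.mem_range.1 ha
    have := Nat.mul_le_mul_left (2 * r + 1) (Nat.succ_le_of_lt hb)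
    rw [Nat.mul_succ] at this
    rw [Nat.abs_cast]
    exact_mod_cast (by omega : a + (2 * r + 1) * b ≤ m)
  calc _ ≤ _ := (measure_mono hcover).trans (measure_union_le _ _)
    _ ≤ B.card * 2⁻¹ ^ r + (B.card * (2 * r + 1) * 2 ^ r : ℕ) * 4⁻¹ ^ r := by
        refine add_le_add hE₁ (hE₂.trans ?_)
        gcongr
    _ = _ := by
        have h4 : (4⁻¹ : ENNReal) = 2⁻¹ * 2⁻¹ := by
          rw [← ENNReal.toReal_eq_toReal_iff' (by finiteness) (by finiteness)]; norm_num
        have h2 : (2 : ENNReal) ^ r * 2⁻¹ ^ r = 1 := by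
          rw [← mul_pow, ENNReal.mul_inv_cancel (by norm_num) (by norm_num), one_pow]
        rw [h4, mul_pow]
        push_cast
        calc _ = (B.card : ENNReal) * 2⁻¹ ^ r
              + B.card * (2 * r + 1) * (2 ^ r * 2⁻¹ ^ r) * 2⁻¹ ^ r := by ring
          _ = _ := by rw [h2]; ring

end Bounds

/-! ### Short walks -/

/-- There is a walk of length at most `L` from `x` to `y`. -/
def Near {V : Type*} (G : SimpleGraph V) (L : ℕ) (x y : V) : Prop :=
  ∃ p : G.Walk x y, p.length ≤ L

theorem Near.refl {V : Type*} (G : SimpleGraph V) (x : V) : Near G 0 x x := ⟨.nil, le_rfl⟩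

theorem Near.symm {V : Type*} {G : SimpleGraph V} {L : ℕ} {x y : V} (h : Near G L x y) :
    Near G L y x := by
  obtain ⟨p, hp⟩ := h
  exact ⟨p.reverse, by simpa using hp⟩

theorem Near.trans {V : Type*} {G : SimpleGraph V} {L L' : ℕ} {x y z : V} (h : Near G L x y)
    (h' : Near G L' y z) : Near G (L + L') x z := by
  obtain ⟨p, hp⟩ := h
  obtain ⟨p', hp'⟩ := h'
  exact ⟨p.append p', by rw [SimpleGraph.Walk.length_append]; omega⟩

theorem Near.mono {V : Type*} {G : SimpleGraph V} {L L' : ℕ} {x y : V} (h : Near G L x y)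
    (hL : L ≤ L') : Near G L' x y := by
  obtain ⟨p, hp⟩ := h
  exact ⟨p, hp.trans hL⟩

theorem near_of_adj {V : Type*} {G : SimpleGraph V} {x y : V} (h : G.Adj x y) : Near G 1 x y :=
  ⟨.cons h .nil, by simp⟩

section Walks

variable {d : ℕ} {c : Edge d → ℝ} {u : ℝ}

theorem sum_abs_sub_step {a a' b : Fin d → ℤ} {i : Fin d} (h : ∀ l, l ≠ i → a' l = a l)
    (hi : |a' i - b i| + 1 = |a i - b i|) : ∑ l, |a' l - b l| + 1 = ∑ l, |a l - b l| := by
  rw [← Finset.add_sum_erase _ _ (Finset.mem_univ i),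
    ← Finset.add_sum_erase (a := i) _ (fun l => |a l - b l|) (Finset.mem_univ i), ← hi,
    Finset.sum_congr rfl fun l hl => by rw [h l (Finset.ne_of_mem_erase hl)]]
  ring

theorem BoxOpen.near {lo hi : Fin d → ℤ} (h : BoxOpen c u lo hi) {L : ℕ} {a b : Fin d → ℤ}
    (ha : ∀ l, lo l ≤ a l ∧ a l ≤ hi l) (hb : ∀ l, lo l ≤ b l ∧ b l ≤ hi l)
    (hL : ∑ l, |a l - b l| ≤ L) : Near (openGraph c u) L a b := by
  induction L generalizing a with
  | zero =>
    have h0 := (Finset.sum_eq_zero_iff_of_nonneg fun l _ => abs_nonneg (a l - b l)).1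
      (le_antisymm (by simpa using hL) (Finset.sum_nonneg fun _ _ => abs_nonneg _))
    obtain rfl : a = b := funext fun l => by
      have := abs_eq_zero.1 (h0 l (Finset.mem_univ l)); omega
    exact Near.refl _ _
  | succ L ih =>
    by_cases hab : a = b
    · subst hab; exact (Near.refl _ _).mono (Nat.zero_le _)
    obtain ⟨i, hi⟩ := Function.ne_iff.1 hab
    rw [add_comm L 1]
    rcases lt_or_gt_of_ne hi with hlt | hlt
    · have hadj := openGraph_adj_of_le (h (a, i) (mem_boxBonds.2 fun l => by
        have h1 := ha l
        have h2 := hb l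
        simp only [Pi.single_apply]
        split_ifs with hl
        · subst hl; omega
        · omega))
      refine (near_of_adj hadj).trans (ih (fun l => ?_) ?_)
      · have h1 := ha l
        have h2 := hb l
        simp only [Pi.add_apply, Pi.single_apply]
        split_ifs with hl
        · subst hl; omega
        · omega
      · have := sum_abs_sub_step (a := a) (a' := a + Pi.single i 1) (b := b) (i := i)
          (fun l hl => by simp [hl]) (by
            simp only [Pi.add_apply, Pi.single_eq_same]
            rw [abs_of_nonpos (by omega), abs_of_nonpos (by omega)]; ring)
        push_cast at hL
        simp only at this ⊢
        omega
    · have hadj := openGraph_adj_of_le (h (a + Pi.single i (-1), i) (mem_boxBonds.2 fun l => by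
        have h1 := ha l
        have h2 := hb l
        simp only [Pi.single_apply, Pi.add_apply]
        split_ifs with hl
        · subst hl; omega
        · omega))
      have hback : a + Pi.single i (-1) + Pi.single i 1 = a := by
        rw [add_assoc, ← Pi.single_add]; simp
      simp only [hback] at hadj
      refine (near_of_adj hadj.symm).trans (ih (fun l => ?_) ?_)
      · have h1 := ha l
        have h2 := hb l
        simp only [Pi.add_apply, Pi.single_apply]
        split_ifs with hl
        · subst hl; omega
        · omega
      · have := sum_abs_sub_step (a := a) (a' := a + Pi.single i (-1)) (b := b) (i := i)
          (fun l hl => by simp [hl]) (by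
            simp only [Pi.add_apply, Pi.single_eq_same]
            rw [abs_of_nonneg (by omega), abs_of_nonneg (by omega)]; ring)
        push_cast at hL
        omega

theorem sum_abs_sub_eq_of_single {a b : Fin d → ℤ} (i : Fin d) (h : ∀ l, l ≠ i → a l = b l) :
    ∑ l, |a l - b l| = |a i - b i| :=
  Finset.sum_eq_single i (fun l _ hl => by simp [h l hl]) (by simp)

/-- An open straight path of length `K` starts at `x`. -/
def HasRay (c : Edge d → ℝ) (u : ℝ) (K : ℕ) (x : Fin d → ℤ) : Prop :=
  ∃ i s, BoxOpen c u (rayLo K x i s) (rayHi K x i s)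

theorem sgn_mul_bound (s : Bool) {t K : ℕ} (ht : t < K) : -(K : ℤ) < sgn s * t ∧ sgn s * t < K := by
  cases s <;> simp [sgn] <;> omega

theorem near_ray {K : ℕ} {x : Fin d → ℤ} {i : Fin d} {s : Bool}
    (h : BoxOpen c u (rayLo K x i s) (rayHi K x i s)) {t : ℕ} (ht : t < K) :
    Near (openGraph c u) K x (x + Pi.single i (sgn s * t)) := by
  refine h.near (fun l => ?_) (fun l => ?_) ?_
  · simp only [rayLo, rayHi, Pi.add_apply, Pi.single_apply]
    split_ifs <;> omega
  · simp only [rayLo, rayHi, sgn, Pi.add_apply, Pi.single_apply]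
    split_ifs <;> omega
  · rw [sum_abs_sub_eq_of_single i fun l hl => by simp [hl]]
    have := sgn_mul_bound s ht
    rw [abs_le]
    simp only [Pi.add_apply, Pi.single_eq_same]
    omega

theorem near_line {M : ℕ} {x : Fin d → ℤ} {i₀ : Fin d}
    (h : BoxOpen c u (x + Pi.single i₀ (-(M : ℤ))) (x + Pi.single i₀ (M : ℤ))) {a b : ℤ}
    (ha : |a| ≤ M) (hb : |b| ≤ M) :
    Near (openGraph c u) (2 * M) (x + Pi.single i₀ a) (x + Pi.single i₀ b) := by
  rw [abs_le] at ha hb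
  refine h.near (fun l => ?_) (fun l => ?_) ?_
  · simp only [Pi.add_apply, Pi.single_apply]
    split_ifs <;> omega
  · simp only [Pi.add_apply, Pi.single_apply]
    split_ifs <;> omega
  · rw [sum_abs_sub_eq_of_single i₀ fun l hl => by simp [hl]]
    rw [abs_le]
    simp only [Pi.add_apply, Pi.single_eq_same]
    omega

/-- A ray orthogonal to `i₀` meets an open line in direction `i₀` directly. A ray along `i₀` is
parallel to these lines; it meets an open slab instead, and the walk moves sideways in the slab to
such a line. The vector `v` is the transverse offset of the line. -/
theorem HasRay.exists_line {i₀ i₁ : Fin d} (hi : i₁ ≠ i₀) {K M n : ℕ} (hKM : K + 2 ≤ M)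
    (hline : LineGood c u i₀ K M n) (hslab : SlabGood c u i₀ (K + 2) n) {x : Fin d → ℤ}
    (hx : x ∈ box d n) (hray : HasRay c u (K + 2) x) :
    ∃ v : Fin d → ℤ, v i₀ = 0 ∧ (∀ l, |v l| ≤ K) ∧
      ∀ a : ℤ, |a| ≤ M → Near (openGraph c u) (4 * M) x (x + v + Pi.single i₀ a) := by
  obtain ⟨i, s, hray⟩ := hray
  by_cases hii : i = i₀
  · subst hii
    obtain ⟨t, ht, hslab⟩ := hslab x hx s
    obtain ⟨t', ht', hline⟩ := hline x hx i₁ hi true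
    have ht := Finset.mem_range.1 ht
    have ht' := Finset.mem_range.1 ht'
    have hb := sgn_mul_bound s ht
    simp only [sgn, if_true, one_mul] at hline
    refine ⟨Pi.single i₁ (t' : ℤ), by simp [hi.symm], fun l => ?_, fun a ha => ?_⟩
    · rw [Pi.single_apply, abs_le]; split_ifs <;> omega
    · have h1 := near_ray hray ht
      have h2 : Near (openGraph c u) K (x + Pi.single i (sgn s * t))
          (x + Pi.single i₁ (t' : ℤ) + Pi.single i (sgn s * t)) := by
        refine hslab.near (fun l => ?_) (fun l => ?_) ?_
        · simp only [slabLo, slabHi, Pi.add_apply, Pi.single_apply]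
          split_ifs <;> omega
        · by_cases hl : l = i
          · subst hl; simp [slabLo, slabHi, hi.symm]
          · simp only [slabLo, slabHi, Pi.add_apply, Pi.single_apply, hl, if_false]
            split_ifs <;> omega
        · rw [sum_abs_sub_eq_of_single i₁ fun l hl => by simp [hl]]
          rw [abs_le]
          simp [hi]
          omega
      have h3 := near_line hline (a := sgn s * t) (b := a) (by rw [abs_le]; omega) ha
      exact ((h1.trans h2).trans h3).mono (by omega)
  · obtain ⟨t, ht, hline⟩ := hline x hx i hii s
    have ht := Finset.mem_range.1 ht
    have hb := sgn_mul_bound s ht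
    refine ⟨Pi.single i (sgn s * t), by simp [Ne.symm hii], fun l => ?_, fun a ha => ?_⟩
    · rw [Pi.single_apply, abs_le]; split_ifs <;> omega
    · have h1 := near_ray hray (by omega : t < K + 2)
      have h3 := near_line hline (a := 0) (b := a) (by simp) ha
      rw [Pi.single_zero, add_zero] at h3
      exact (h1.trans h3).mono (by omega)

/-- The lines reached from `x` and from `z` both cross one open slab near `z`, orthogonal to `i₀`,
inside which they are joined. The slab radius `K + 2` allows for an offset up to `K` of the line and
a transverse distance up to `2` between `x` and `z`. -/
theorem near_of_hasRay {i₀ i₁ : Fin d} (hi : i₁ ≠ i₀) {K M m n : ℕ} (hM : m + K + 4 ≤ M)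
    (hline : LineGood c u i₀ K M n) (hslab : SlabGood c u i₀ (K + 2) n) {x z : Fin d → ℤ}
    (hx : x ∈ box d n) (hz : z ∈ box d n) (hrx : HasRay c u (K + 2) x)
    (hrz : HasRay c u (K + 2) z) (hxz : ∀ l, l ≠ i₀ → |x l - z l| ≤ 2)
    (hxz₀ : |x i₀ - z i₀| ≤ m + 2) : Near (openGraph c u) ((2 * d + 8) * M) x z := by
  obtain ⟨v, hv0, hv, hxv⟩ := hrx.exists_line hi (by omega) hline hslab hx
  obtain ⟨v', hv0', hv', hzv⟩ := hrz.exists_line hi (by omega) hline hslab hz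
  obtain ⟨t, ht, hslab⟩ := hslab z hz true
  have ht := Finset.mem_range.1 ht
  simp only [sgn, if_true, one_mul] at hslab
  rw [abs_le] at hxz₀
  have h1 := hxv (z i₀ + t - x i₀) (by rw [abs_le]; omega)
  have h2 := hzv t (by rw [abs_le]; omega)
  have h3 : Near (openGraph c u) (2 * d * M) (x + v + Pi.single i₀ (z i₀ + t - x i₀))
      (z + v' + Pi.single i₀ (t : ℤ)) := by
    refine hslab.near (fun l => ?_) (fun l => ?_) ?_
    · by_cases hl : l = i₀
      · subst hl; simp [slabLo, slabHi, hv0]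
      · have := abs_le.1 (hxz l hl)
        have := abs_le.1 (hv l)
        simp only [slabLo, slabHi, Pi.add_apply, Pi.single_apply, hl, if_false]
        omega
    · by_cases hl : l = i₀
      · subst hl; simp [slabLo, slabHi, hv0']
      · have := abs_le.1 (hv' l)
        simp only [slabLo, slabHi, Pi.add_apply, Pi.single_apply, hl, if_false]
        omega
    · calc _ ≤ ∑ _l : Fin d, 2 * (M : ℤ) := Finset.sum_le_sum fun l _ => by
            by_cases hl : l = i₀
            · subst hl; simp [hv0, hv0']
            · have := abs_le.1 (hxz l hl)
              have := abs_le.1 (hv l)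
              have := abs_le.1 (hv' l)
              simp only [Pi.add_apply, Pi.single_apply, hl, if_false]
              rw [abs_le]
              omega
        _ = _ := by simp; ring
  exact ((h1.trans h3).trans h2.symm).mono (by ring_nf; rfl)

theorem cond_eq {x y : Fin d → ℤ} (h : (lattice d).Adj x y) :
    cond c x y = c ⟨s(x, y), h⟩ := dif_pos h

theorem cond_symm (x y : Fin d → ℤ) : cond c x y = cond c y x := by
  by_cases h : (lattice d).Adj x y
  · rw [cond_eq h, cond_eq h.symm]
    congr 1
    exact Subtype.ext Sym2.eq_swap
  · rw [cond, cond, dif_neg h, dif_neg fun h' => h h'.symm]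

theorem le_cond_of_openGraph_adj {x y : Fin d → ℤ} (h : (openGraph c u).Adj x y) :
    u ≤ cond c x y := by
  obtain ⟨h, hc⟩ := h
  rwa [cond_eq h]

theorem cond_nonneg (hc : ∀ e, 0 ≤ c e) (x y : Fin d → ℤ) : 0 ≤ cond c x y := by
  rw [cond]; split_ifs
  · exact hc _
  · exact le_rfl

theorem cond_le_one (hc : ∀ e, c e ≤ 1) (x y : Fin d → ℤ) : cond c x y ≤ 1 := by
  rw [cond]; split_ifs
  · exact hc _
  · exact zero_le_one

theorem card_nbrs_le (x : Fin d → ℤ) : (nbrs x).card ≤ 2 * d := by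
  classical
  calc (nbrs x).card ≤ ((Finset.univ : Finset (Fin d × Bool)).image
        fun k => x + Pi.single k.1 (sgn k.2)).card := by
        refine Finset.card_le_card fun y hy => Finset.mem_image.2 ?_
        obtain ⟨i, rfl | rfl⟩ := exists_bond_of_adj (mem_nbrs.1 hy)
        · exact ⟨(i, true), Finset.mem_univ _, by simp [sgn]⟩
        · refine ⟨(i, false), Finset.mem_univ _, ?_⟩
          funext l
          by_cases hl : l = i
          · subst hl; simp [sgn]
          · simp [hl]
    _ ≤ 2 * d := Finset.card_image_le.trans (by simp [mul_comm])

/-- The neighbour `y` has the largest of at most `2d` conductances. For the weight `π(x)`, the step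
from `x` to `y` is affordable even if its conductance is tiny. -/
theorem exists_le_cond (hd : 0 < d) (hc : ∀ e, 0 ≤ c e) (x : Fin d → ℤ) :
    ∃ y, (lattice d).Adj x y ∧ condMeasure c x ≤ 2 * d * cond c x y := by
  obtain ⟨y, hy, hmax⟩ := (nbrs x).exists_max_image (cond c x)
    ⟨_, mem_nbrs.2 (lattice_adj_add_single x ⟨0, hd⟩)⟩
  refine ⟨y, mem_nbrs.1 hy, ?_⟩
  calc condMeasure c x ≤ (nbrs x).card * cond c x y := by
        rw [condMeasure, ← nsmul_eq_mul]
        exact Finset.sum_le_card_nsmul _ _ _ hmax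
    _ ≤ 2 * d * cond c x y := by
        have : ((nbrs x).card : ℝ) ≤ 2 * d := by exact_mod_cast card_nbrs_le x
        exact mul_le_mul_of_nonneg_right this (cond_nonneg hc x y)

theorem abs_sub_le_one_of_adj {x y : Fin d → ℤ} (h : (lattice d).Adj x y) (l : Fin d) :
    |x l - y l| ≤ 1 := by
  have h' : ∑ i, |x i - y i| = 1 := h
  rw [← h']
  exact Finset.single_le_sum (f := fun i => |x i - y i|) (fun j _ => abs_nonneg _)
    (Finset.mem_univ l)

theorem PairGood.hasRay {K n : ℕ} (h : PairGood c u K n) {x y : Fin d → ℤ}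
    (hx : x ∈ box d n) (hy : y ∈ box d n) (hxy : (lattice d).Adj x y) :
    HasRay c u K x ∨ HasRay c u K y := by
  have key : ∀ z ∈ box d n, ∀ i, HasRay c u K z ∨ HasRay c u K (z + Pi.single i 1) := by
    intro z hz i
    obtain ⟨e, i', s, he⟩ := h z hz i
    cases e
    · exact Or.inl ⟨i', s, by simpa using he⟩
    · exact Or.inr ⟨i', s, by simpa using he⟩
  obtain ⟨i, rfl | rfl⟩ := exists_bond_of_adj hxy
  · exact key x hx i
  · exact (key y hy i).symm

theorem exists_adj_of_mem_cluster {ξ : ℝ} {z : Fin d → ℤ} (hz : z ∈ cluster c ξ) :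
    ∃ z', (openGraph c ξ).Adj z z' := by
  obtain ⟨z', hz', hne⟩ := Set.Infinite.exists_notMem_finset hz {z}
  obtain ⟨p⟩ := hz'
  cases p with
  | nil => simp at hne
  | cons h _ => exact ⟨_, h⟩

theorem mem_box_of_abs_sub_le {n n' r : ℕ} {x y : Fin d → ℤ} (hx : x ∈ box d n)
    (h : ∀ l, |x l - y l| ≤ r) (hn : n + r ≤ n') : y ∈ box d n' := by
  simp only [box, Finset.mem_Icc, Pi.le_def] at hx ⊢
  constructor <;> intro l <;> have h1 := hx.1 l <;> have h2 := hx.2 l <;>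
    have h3 := abs_le.1 (h l) <;> omega

/-- Under the pair condition, `x` is connected to the sites of the infinite cluster on the same
line, up to one step to the neighbour with the best conductance. -/
theorem PairGood.near {i₀ i₁ : Fin d} (hi : i₁ ≠ i₀) (hc : ∀ e, 0 ≤ c e) {K M m n : ℕ}
    (hM : m + K + 4 ≤ M) {ξ : ℝ} (hu : u ≤ ξ) (hpair : PairGood c u (K + 2) (n + 1))
    (hline : LineGood c u i₀ K M (n + 1)) (hslab : SlabGood c u i₀ (K + 2) (n + 1))
    {x z : Fin d → ℤ} (hx : x ∈ box d n) (hz : z ∈ box d n) (hzC : z ∈ cluster c ξ)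
    (hxz : ∀ l, l ≠ i₀ → x l = z l) (hxz₀ : |x i₀ - z i₀| ≤ m) :
    ∃ y, (y = x ∨ (lattice d).Adj x y ∧ condMeasure c x ≤ 2 * d * cond c x y) ∧
      Near (openGraph c u) ((2 * d + 9) * M) y z := by
  have hn1 {a b : Fin d → ℤ} (ha : a ∈ box d n) (hab : (lattice d).Adj a b) :
      b ∈ box d (n + 1) :=
    mem_box_of_abs_sub_le (r := 1) ha (fun l => by exact_mod_cast abs_sub_le_one_of_adj hab l)
      le_rfl
  have hn0 : box d n ⊆ box d (n + 1) := box_subset (Nat.le_succ n)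
  obtain ⟨y, hyb, hyx, hy, hry⟩ : ∃ y ∈ box d (n + 1), (∀ l, |x l - y l| ≤ 1) ∧
      (y = x ∨ (lattice d).Adj x y ∧ condMeasure c x ≤ 2 * d * cond c x y) ∧
      HasRay c u (K + 2) y := by
    obtain ⟨y, hxy, hy⟩ := exists_le_cond i₀.pos hc x
    rcases hpair.hasRay (hn0 hx) (hn1 hx hxy) hxy with h | h
    · exact ⟨x, hn0 hx, by simp, Or.inl rfl, h⟩
    · exact ⟨y, hn1 hx hxy, abs_sub_le_one_of_adj hxy, Or.inr ⟨hxy, hy⟩, h⟩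
  -- A cluster site has a bond of conductance at least `ξ ≥ u`, so moving to the better endpoint of
  -- that bond is an ordinary step of the walk.
  obtain ⟨z', hzb, hzz', hzn, hrz⟩ : ∃ z' ∈ box d (n + 1), (∀ l, |z l - z' l| ≤ 1) ∧
      Near (openGraph c u) 1 z' z ∧ HasRay c u (K + 2) z' := by
    obtain ⟨z', hzz', hξ⟩ := exists_adj_of_mem_cluster hzC
    rcases hpair.hasRay (hn0 hz) (hn1 hz hzz') hzz' with h | h
    · exact ⟨z, hn0 hz, by simp, (Near.refl _ _).mono zero_le_one, h⟩
    · exact ⟨z', hn1 hz hzz', abs_sub_le_one_of_adj hzz',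
        (near_of_adj (show (openGraph c u).Adj z z' from ⟨hzz', hu.trans hξ⟩)).symm, h⟩
  refine ⟨y, hy, ((near_of_hasRay (m := m) hi hM hline hslab hyb hzb hry hrz (fun l hl => ?_)
    ?_).trans hzn).mono ?_⟩
  · have h1 := abs_le.1 (hyx l); have h2 := abs_le.1 (hzz' l); have h3 := hxz l hl
    rw [abs_le]; omega
  · have h1 := abs_le.1 (hyx i₀); have h2 := abs_le.1 (hzz' i₀); have h3 := abs_le.1 hxz₀
    rw [abs_le]; omega
  · have : 1 ≤ M := by omega
    calc (2 * d + 8) * M + 1 ≤ (2 * d + 8) * M + M := by omega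
      _ = (2 * d + 9) * M := by ring

end Walks

/-! ### The functional inequality -/

section Energy

variable {d : ℕ} {c : Edge d → ℝ}

/-- The energy of `f` at the site `a`, restricted to bonds leading to `Λ`. -/
def localEnergy (c : Edge d → ℝ) (Λ : Finset (Fin d → ℤ)) (f : (Fin d → ℤ) → ℝ)
    (a : Fin d → ℤ) : ℝ :=
  ∑ b ∈ Λ, cond c a b * (f a - f b) ^ 2

theorem localEnergy_nonneg (hc : ∀ e, 0 ≤ c e) (Λ : Finset (Fin d → ℤ)) (f : (Fin d → ℤ) → ℝ)
    (a : Fin d → ℤ) : 0 ≤ localEnergy c Λ f a :=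
  Finset.sum_nonneg fun _ _ => mul_nonneg (cond_nonneg hc _ _) (sq_nonneg _)

theorem le_localEnergy (hc : ∀ e, 0 ≤ c e) {Λ : Finset (Fin d → ℤ)} (f : (Fin d → ℤ) → ℝ)
    (a : Fin d → ℤ) {b : Fin d → ℤ} (hb : b ∈ Λ) :
    cond c a b * (f a - f b) ^ 2 ≤ localEnergy c Λ f a :=
  Finset.single_le_sum (f := fun b => cond c a b * (f a - f b) ^ 2)
    (fun _ _ => mul_nonneg (cond_nonneg hc _ _) (sq_nonneg _)) hb

/-- The cube of radius `R` around `x`. -/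
def cube (x : Fin d → ℤ) (R : ℕ) : Finset (Fin d → ℤ) :=
  Finset.Icc (fun l => x l - R) (fun l => x l + R)

theorem mem_cube {x y : Fin d → ℤ} {R : ℕ} : y ∈ cube x R ↔ ∀ l, |x l - y l| ≤ R := by
  simp only [cube, Finset.mem_Icc, Pi.le_def, abs_le]
  constructor
  · intro h l; have h1 := h.1 l; have h2 := h.2 l; omega
  · intro h; constructor <;> intro l <;> have := h l <;> omega

theorem card_cube (x : Fin d → ℤ) (R : ℕ) : (cube x R).card = (2 * R + 1) ^ d := by
  rw [cube, Pi.card_Icc, Finset.prod_congr rfl (g := fun _ => 2 * R + 1), Finset.prod_const,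
    Finset.card_univ, Fintype.card_fin]
  intro i _
  rw [Int.card_Icc]
  omega

theorem sum_sum_cube_le {B Λ : Finset (Fin d → ℤ)} {R : ℕ} {g : (Fin d → ℤ) → ℝ}
    (hg : ∀ a, 0 ≤ g a) (hΛ : ∀ x ∈ B, cube x R ⊆ Λ) :
    ∑ x ∈ B, ∑ a ∈ cube x R, g a ≤ (2 * R + 1) ^ d * ∑ a ∈ Λ, g a := by
  classical
  rw [Finset.sum_comm' (t' := Λ) (s' := fun a => B.filter fun x => a ∈ cube x R)
    (by intro x a; simp only [Finset.mem_filter]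
        exact ⟨fun h => ⟨h, hΛ x h.1 h.2⟩, fun h => h.1⟩), Finset.mul_sum]
  refine Finset.sum_le_sum fun a _ => ?_
  rw [Finset.sum_const, nsmul_eq_mul]
  refine mul_le_mul_of_nonneg_right ?_ (hg a)
  have : (B.filter fun x => a ∈ cube x R).card ≤ (cube a R).card :=
    Finset.card_le_card fun x hx => mem_cube.2 fun l => by
      rw [abs_sub_comm]; exact mem_cube.1 (Finset.mem_filter.1 hx).2 l
  rw [card_cube] at this
  exact_mod_cast this

theorem abs_sub_le_length_mul {V : Type*} {G : SimpleGraph V} {f : V → ℝ} {δ : ℝ} {y z : V}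
    (p : G.Walk y z) (h : ∀ a ∈ p.support, ∀ b, G.Adj a b → |f a - f b| ≤ δ) :
    |f y - f z| ≤ p.length * δ := by
  induction p with
  | nil => simp
  | cons hadj p ih =>
    have h1 := h _ (by simp) _ hadj
    have h2 := ih fun a ha => h a (by simp [ha])
    push_cast [SimpleGraph.Walk.length_cons]
    calc _ ≤ _ := abs_sub_le _ _ _
      _ ≤ _ := add_le_add h1 h2
      _ = _ := by ring

theorem mem_cube_of_mem_support {u : ℝ} {y z : Fin d → ℤ} (p : (openGraph c u).Walk y z) :
    ∀ a ∈ p.support, a ∈ cube y p.length := by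
  induction p with
  | nil => intro a ha; rw [mem_cube]; simp at ha; simp [ha]
  | cons hadj p ih =>
    intro a ha
    rw [mem_cube]
    intro l
    rcases List.mem_cons.1 (by simpa using ha) with rfl | ha
    · simp; omega
    · have h1 := mem_cube.1 (ih a ha) l
      have h2 := abs_sub_le_one_of_adj hadj.1 l
      rw [abs_le] at h1 h2 ⊢
      push_cast [SimpleGraph.Walk.length_cons]
      omega

/-- Each increment along the walk is at most the square root of the whole nearby energy over `u`;
summing `L` of them gives the factor `L ^ 2`. The radius is `L + 1` because `y` may differ from `x`
by one step. -/
theorem sq_sub_le_of_near (hc : ∀ e, 0 ≤ c e) {u : ℝ} (hu : 0 < u) {Λ : Finset (Fin d → ℤ)}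
    {L : ℕ} {x y z : Fin d → ℤ} (f : (Fin d → ℤ) → ℝ) (hxy : ∀ l, |x l - y l| ≤ 1)
    (hyz : Near (openGraph c u) L y z) (hΛ : cube x (L + 2) ⊆ Λ) :
    (f y - f z) ^ 2 ≤ L ^ 2 / u * ∑ a ∈ cube x (L + 1), localEnergy c Λ f a := by
  obtain ⟨p, hp⟩ := hyz
  set S := ∑ a ∈ cube x (L + 1), localEnergy c Λ f a with hS
  have hS0 : 0 ≤ S := Finset.sum_nonneg fun _ _ => localEnergy_nonneg hc _ _ _
  have hstep : ∀ a ∈ p.support, ∀ b, (openGraph c u).Adj a b → |f a - f b| ≤ √(S / u) := by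
    intro a ha b hab
    have hax : ∀ l, |x l - a l| ≤ L + 1 := fun l => by
      have h1 := mem_cube.1 (mem_cube_of_mem_support p a ha) l
      have h2 := hxy l
      rw [abs_le] at h1 h2 ⊢
      omega
    have hbx : b ∈ Λ := hΛ <| mem_cube.2 fun l => by
      have h1 := hax l
      have h2 := abs_sub_le_one_of_adj hab.1 l
      rw [abs_le] at h1 h2 ⊢
      push_cast
      omega
    refine Real.abs_le_sqrt ?_
    rw [le_div_iff₀' hu]
    calc u * (f a - f b) ^ 2 ≤ cond c a b * (f a - f b) ^ 2 :=
          mul_le_mul_of_nonneg_right (le_cond_of_openGraph_adj hab) (sq_nonneg _)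
      _ ≤ localEnergy c Λ f a := le_localEnergy hc f a hbx
      _ ≤ S := Finset.single_le_sum (f := localEnergy c Λ f)
          (fun _ _ => localEnergy_nonneg hc _ _ _) (mem_cube.2 fun l => by exact_mod_cast hax l)
  have h1 := abs_sub_le_length_mul p hstep
  have h2 : |f y - f z| ≤ L * √(S / u) :=
    h1.trans (mul_le_mul_of_nonneg_right (by exact_mod_cast hp) (Real.sqrt_nonneg _))
  calc (f y - f z) ^ 2 = |f y - f z| ^ 2 := (sq_abs _).symm
    _ ≤ (L * √(S / u)) ^ 2 := pow_le_pow_left₀ (abs_nonneg _) h2 2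
    _ = L ^ 2 * (S / u) := by rw [mul_pow, Real.sq_sqrt (div_nonneg hS0 hu.le)]
    _ = L ^ 2 / u * S := by ring

/-- Here `t` stands for `θ x`. The first step is charged to its own conductance and the rest of the
walk to `u`; since `L ^ 2 / u ≥ 1`, the second bound absorbs the first. -/
theorem weighted_sq_sub_le (hc : ∀ e, 0 ≤ c e) {u : ℝ} (hu : 0 < u) (hu1 : u ≤ 1)
    {Λ : Finset (Fin d → ℤ)} {L : ℕ} (hL : 1 ≤ L) {x y z : Fin d → ℤ} (f : (Fin d → ℤ) → ℝ)
    {t : ℝ} (ht0 : 0 ≤ t) (ht : t ≤ 2 * d)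
    (hxy : y = x ∨ (lattice d).Adj x y ∧ t ≤ 2 * d * cond c x y)
    (hyz : Near (openGraph c u) L y z) (hΛ : cube x (L + 2) ⊆ Λ) :
    t * (f x - f z) ^ 2 ≤ 8 * d * L ^ 2 / u * ∑ a ∈ cube x (L + 1), localEnergy c Λ f a := by
  set S := ∑ a ∈ cube x (L + 1), localEnergy c Λ f a with hS
  have hd0 : (0 : ℝ) ≤ d := Nat.cast_nonneg d
  have hS0 : 0 ≤ S := Finset.sum_nonneg fun _ _ => localEnergy_nonneg hc _ _ _
  have hxy1 : ∀ l, |x l - y l| ≤ 1 := by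
    rcases hxy with rfl | h
    · simp
    · exact abs_sub_le_one_of_adj h.1
  have h1 := sq_sub_le_of_near hc hu f hxy1 hyz hΛ
  rw [← hS] at h1
  have hLu : 1 ≤ (L : ℝ) ^ 2 / u := by
    rw [le_div_iff₀ hu, one_mul]
    exact hu1.trans (one_le_pow₀ (by exact_mod_cast hL))
  have hSL : S ≤ (L : ℝ) ^ 2 / u * S := le_mul_of_one_le_left hS0 hLu
  have h2 : t * (f x - f y) ^ 2 ≤ 2 * d * S := by
    rcases hxy with rfl | h
    · simp; positivity
    · calc t * (f x - f y) ^ 2 ≤ 2 * d * cond c x y * (f x - f y) ^ 2 :=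
            mul_le_mul_of_nonneg_right h.2 (sq_nonneg _)
        _ = 2 * d * (cond c x y * (f x - f y) ^ 2) := by ring
        _ ≤ 2 * d * S := by
            refine mul_le_mul_of_nonneg_left ?_ (by positivity)
            refine (le_localEnergy hc f x (hΛ (mem_cube.2 fun l => (hxy1 l).trans ?_))).trans
              (Finset.single_le_sum (f := localEnergy c Λ f)
                (fun _ _ => localEnergy_nonneg hc _ _ _) (mem_cube.2 fun l => ?_))
            · push_cast; omega
            · simp; omega
  have h3 : t * (f y - f z) ^ 2 ≤ 2 * d * ((L : ℝ) ^ 2 / u * S) :=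
    mul_le_mul ht h1 (sq_nonneg _) (by positivity)
  have h4 : (f x - f z) ^ 2 ≤ 2 * (f x - f y) ^ 2 + 2 * (f y - f z) ^ 2 := by
    nlinarith [sq_nonneg ((f x - f y) - (f y - f z))]
  calc t * (f x - f z) ^ 2 ≤ t * (2 * (f x - f y) ^ 2 + 2 * (f y - f z) ^ 2) :=
        mul_le_mul_of_nonneg_left h4 ht0
    _ = 2 * (t * (f x - f y) ^ 2) + 2 * (t * (f y - f z) ^ 2) := by ring
    _ ≤ 2 * (2 * d * ((L : ℝ) ^ 2 / u * S)) + 2 * (2 * d * ((L : ℝ) ^ 2 / u * S)) := by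
        have : 2 * (d : ℝ) * S ≤ 2 * d * ((L : ℝ) ^ 2 / u * S) :=
          mul_le_mul_of_nonneg_left hSL (by positivity)
        linarith
    _ = 8 * d * L ^ 2 / u * S := by ring

open scoped Classical in
/-- If the sites of `B` outside `C` can be matched with sites of `C` by short walks, then the mass
of `f` is controlled by its mass on `C` and its energy. -/
theorem sum_sq_le_of_matching (hc : ∀ e, 0 ≤ c e) {θ : (Fin d → ℤ) → ℝ} (hθ0 : ∀ x, 0 ≤ θ x)
    (hθ : ∀ x, θ x ≤ 2 * d) {u : ℝ} (hu : 0 < u) (hu1 : u ≤ 1) {L : ℕ} (hL : 1 ≤ L)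
    {B Λ : Finset (Fin d → ℤ)} (hΛ : ∀ x ∈ B, cube x (L + 2) ⊆ Λ) {C : Set (Fin d → ℤ)} {A : ℝ}
    (hA : ∀ x, ∀ z ∈ C, 2 * θ x ≤ A * θ z) (φ : (Fin d → ℤ) → (Fin d → ℤ))
    (hφC : ∀ x ∈ B, x ∉ C → φ x ∈ C) (hφ : Set.InjOn φ {x | x ∈ B ∧ x ∉ C})
    (hnear : ∀ x ∈ B, x ∉ C → ∃ y, (y = x ∨ (lattice d).Adj x y ∧ θ x ≤ 2 * d * cond c x y) ∧
      Near (openGraph c u) L y (φ x)) {f : (Fin d → ℤ) → ℝ} (hf : ∀ x ∉ B, f x = 0) :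
    ∑ x ∈ B, θ x * f x ^ 2 ≤ (1 + A) * ∑ x ∈ B.filter (· ∈ C), θ x * f x ^ 2
      + 32 * d * L ^ 2 * (2 * L + 3) ^ d / u * (1 / 2 * ∑ a ∈ Λ, localEnergy c Λ f a) := by
  set H := B.filter (· ∉ C) with hH
  have hmem : ∀ x ∈ H, x ∈ B ∧ x ∉ C := fun x hx => Finset.mem_filter.1 hx
  have hΛ1 : ∀ x ∈ B, cube x (L + 1) ⊆ Λ := fun x hx a ha => hΛ x hx <| mem_cube.2 fun l =>
    (mem_cube.1 ha l).trans (by push_cast; omega)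
  have hW : (0 : ℝ) ≤ 16 * d * L ^ 2 / u := by positivity
  have hpt : ∀ x ∈ H, θ x * f x ^ 2 ≤ A * (θ (φ x) * f (φ x) ^ 2)
      + 16 * d * L ^ 2 / u * ∑ a ∈ cube x (L + 1), localEnergy c Λ f a := by
    intro x hx
    obtain ⟨hxB, hxC⟩ := hmem x hx
    obtain ⟨y, hy, hyz⟩ := hnear x hxB hxC
    have h1 := weighted_sq_sub_le hc hu hu1 hL f (hθ0 x) (hθ x) hy hyz (hΛ x hxB)
    have h2 : f x ^ 2 ≤ 2 * f (φ x) ^ 2 + 2 * (f x - f (φ x)) ^ 2 := by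
      nlinarith [sq_nonneg (2 * f (φ x) - f x)]
    calc θ x * f x ^ 2 ≤ θ x * (2 * f (φ x) ^ 2 + 2 * (f x - f (φ x)) ^ 2) :=
          mul_le_mul_of_nonneg_left h2 (hθ0 x)
      _ = 2 * θ x * f (φ x) ^ 2 + 2 * (θ x * (f x - f (φ x)) ^ 2) := by ring
      _ ≤ A * θ (φ x) * f (φ x) ^ 2 + 2 * (8 * d * L ^ 2 / u *
            ∑ a ∈ cube x (L + 1), localEnergy c Λ f a) :=
          add_le_add (mul_le_mul_of_nonneg_right (hA x _ (hφC x hxB hxC)) (sq_nonneg _))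
            (mul_le_mul_of_nonneg_left h1 zero_le_two)
      _ = _ := by ring
  -- By injectivity each matched site is counted once. Those outside `B` contribute nothing because
  -- `f` vanishes there, and `hA` supplies the needed sign of `A * θ z` on `C`.
  have hmatch : ∑ x ∈ H, A * (θ (φ x) * f (φ x) ^ 2)
      ≤ A * ∑ x ∈ B.filter (· ∈ C), θ x * f x ^ 2 := by
    rcases H.eq_empty_or_nonempty with hHe | ⟨x₀, hx₀⟩
    · rw [hHe, Finset.sum_empty, Finset.mul_sum]
      refine Finset.sum_nonneg fun x hx => ?_
      rw [← mul_assoc]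
      refine mul_nonneg ?_ (sq_nonneg _)
      exact (by have := hθ0 x; linarith : 0 ≤ 2 * θ x).trans (hA x x (Finset.mem_filter.1 hx).2)
    · rw [← Finset.sum_image (s := H) (g := φ) (f := fun z => A * (θ z * f z ^ 2))
        (fun x hx y hy h => hφ (hmem x hx) (hmem y hy) h), Finset.mul_sum]
      have hAθ : ∀ z ∈ C, 0 ≤ A * (θ z * f z ^ 2) := fun z hz => by
        rw [← mul_assoc]
        exact mul_nonneg ((by have := hθ0 z; linarith : 0 ≤ 2 * θ z).trans (hA z z hz))
          (sq_nonneg _)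
      have himage : ∀ z ∈ H.image φ, z ∈ C := fun z hz => by
        obtain ⟨x, hx, rfl⟩ := Finset.mem_image.1 hz
        exact hφC x (hmem x hx).1 (hmem x hx).2
      rw [← Finset.sum_filter_of_ne (s := H.image φ) (p := (· ∈ B)) fun z _ hz => by
        by_contra hzB
        exact hz (by rw [hf z hzB]; ring)]
      refine Finset.sum_le_sum_of_subset_of_nonneg (fun z hz => ?_)
        fun z hz _ => hAθ z (Finset.mem_filter.1 hz).2
      obtain ⟨hz, hzB⟩ := Finset.mem_filter.1 hz
      exact Finset.mem_filter.2 ⟨hzB, himage z hz⟩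
  have hcubes : ∑ x ∈ H, ∑ a ∈ cube x (L + 1), localEnergy c Λ f a
      ≤ (2 * L + 3) ^ d * ∑ a ∈ Λ, localEnergy c Λ f a := by
    have := sum_sum_cube_le (localEnergy_nonneg hc Λ f) fun x hx => hΛ1 x (hmem x hx).1
    refine this.trans (le_of_eq ?_)
    push_cast
    ring
  calc ∑ x ∈ B, θ x * f x ^ 2
      = ∑ x ∈ B.filter (· ∈ C), θ x * f x ^ 2 + ∑ x ∈ H, θ x * f x ^ 2 :=
        (Finset.sum_filter_add_sum_filter_not _ _ _).symm
    _ ≤ ∑ x ∈ B.filter (· ∈ C), θ x * f x ^ 2 + (A * ∑ x ∈ B.filter (· ∈ C), θ x * f x ^ 2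
        + 16 * d * L ^ 2 / u * ((2 * L + 3) ^ d * ∑ a ∈ Λ, localEnergy c Λ f a)) := by
        refine add_le_add le_rfl ((Finset.sum_le_sum hpt).trans ?_)
        rw [Finset.sum_add_distrib]
        refine add_le_add hmatch ?_
        rw [← Finset.mul_sum]
        exact mul_le_mul_of_nonneg_left hcubes hW
    _ = _ := by ring

/-- Summation by parts. -/
theorem sum_mul_sum_nbrs {A Λ : Finset (Fin d → ℤ)} (hA : A ⊆ Λ) (hΛ : ∀ x ∈ A, nbrs x ⊆ Λ)
    (f : (Fin d → ℤ) → ℝ) {g : (Fin d → ℤ) → ℝ} (hg : ∀ x ∉ A, g x = 0) :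
    ∑ x ∈ A, g x * ∑ y ∈ nbrs x, cond c x y * (f x - f y)
      = 1 / 2 * ∑ x ∈ Λ, ∑ y ∈ Λ, cond c x y * ((f x - f y) * (g x - g y)) := by
  have h1 : ∑ x ∈ A, g x * ∑ y ∈ nbrs x, cond c x y * (f x - f y)
      = ∑ x ∈ Λ, ∑ y ∈ Λ, cond c x y * ((f x - f y) * g x) := by
    rw [← Finset.sum_subset hA fun x _ hx => by simp [hg x hx]]
    refine Finset.sum_congr rfl fun x hx => ?_
    rw [Finset.mul_sum, ← Finset.sum_subset (hΛ x hx) fun y _ hy => by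
      rw [cond, dif_neg fun h => hy (mem_nbrs.2 h), zero_mul]]
    exact Finset.sum_congr rfl fun y _ => by ring
  have h2 : ∑ x ∈ Λ, ∑ y ∈ Λ, cond c x y * ((f x - f y) * g x)
      = ∑ x ∈ Λ, ∑ y ∈ Λ, cond c x y * ((f x - f y) * -g y) := by
    rw [Finset.sum_comm]
    refine Finset.sum_congr rfl fun x _ => Finset.sum_congr rfl fun y _ => ?_
    rw [cond_symm]; ring
  have h3 : ∑ x ∈ Λ, ∑ y ∈ Λ, cond c x y * ((f x - f y) * (g x - g y))
      = ∑ x ∈ Λ, ∑ y ∈ Λ, cond c x y * ((f x - f y) * g x)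
        + ∑ x ∈ Λ, ∑ y ∈ Λ, cond c x y * ((f x - f y) * -g y) := by
    simp only [← Finset.sum_add_distrib]
    exact Finset.sum_congr rfl fun x _ => Finset.sum_congr rfl fun y _ => by ring
  rw [h1, h3, ← h2]; ring

end Energy

/-! ### Principal eigenvalues -/

/-- An operator that is symmetric for a weighted inner product has a real eigenvalue. -/
theorem exists_hasEigenvalue_of_weighted_symm {ι : Type*} [Fintype ι] [Nonempty ι]
    (D : Module.End ℝ (ι → ℝ)) {w : ι → ℝ} (hw : ∀ i, 0 < w i)
    (hD : ∀ g h : ι → ℝ, ∑ i, w i * (D g i * h i) = ∑ i, w i * (g i * D h i)) :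
    ∃ μ, D.HasEigenvalue μ := by
  have hs : ∀ i, √(w i) ≠ 0 := fun i => (Real.sqrt_pos.2 (hw i)).ne'
  -- Dividing by `√w` carries the Euclidean inner product to the weighted one, so the conjugated
  -- operator is symmetric and the spectral theorem applies.
  let Φ : EuclideanSpace ℝ ι ≃ₗ[ℝ] (ι → ℝ) := (WithLp.linearEquiv 2 ℝ (ι → ℝ)).trans
    (LinearEquiv.piCongrRight fun i => LinearEquiv.smulOfNeZero ℝ ℝ (√(w i))⁻¹ (inv_ne_zero (hs i)))
  have hΦ : ∀ g i, g i = √(w i) * Φ g i := fun g i => by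
    simp [Φ, hs i]
  let S : EuclideanSpace ℝ ι →ₗ[ℝ] EuclideanSpace ℝ ι := Φ.symm.conj D
  have hS : ∀ g, Φ (S g) = D (Φ g) := fun g => by simp [S, LinearEquiv.conj_apply]
  have hsymm : S.IsSymmetric := fun g h => by
    simp only [PiLp.inner_apply, RCLike.inner_apply, conj_trivial]
    have hsq : ∀ i, √(w i) * √(w i) = w i := fun i => Real.mul_self_sqrt (hw i).le
    calc ∑ i, h i * S g i = ∑ i, w i * (D (Φ g) i * Φ h i) :=
          Finset.sum_congr rfl fun i _ => by
            rw [hΦ h i, hΦ (S g) i, hS]; linear_combination (Φ h i * D (Φ g) i) * hsq i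
      _ = ∑ i, w i * (Φ g i * D (Φ h) i) := hD _ _
      _ = ∑ i, S h i * g i := Finset.sum_congr rfl fun i _ => by
            rw [hΦ g i, hΦ (S h) i, hS]; linear_combination (-Φ g i * D (Φ h) i) * hsq i
  obtain ⟨v, hv⟩ := hsymm.hasEigenvalue_iInf_of_finiteDimensional.exists_hasEigenvector
  have hDv := hS v
  rw [hv.apply_eq_smul, map_smul] at hDv
  have hv0 : Φ v ≠ 0 := fun h => hv.2 (by simpa using h)
  exact ⟨_, Module.End.hasEigenvalue_of_hasEigenvector
    ⟨Module.End.mem_eigenspace_iff.2 hDv.symm, hv0⟩⟩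

section Dirichlet

variable {d : ℕ} {c : Edge d → ℝ}

/-- Extension by zero outside `B`. -/
def extendZero (B : Finset (Fin d → ℤ)) (g : ↥(B : Set (Fin d → ℤ)) → ℝ) : (Fin d → ℤ) → ℝ :=
  Function.extend Subtype.val g 0

theorem extendZero_apply (B : Finset (Fin d → ℤ)) (g : ↥(B : Set (Fin d → ℤ)) → ℝ)
    (x : ↥(B : Set (Fin d → ℤ))) : extendZero B g x = g x :=
  Subtype.val_injective.extend_apply g 0 x

theorem extendZero_of_notMem {B : Finset (Fin d → ℤ)} (g : ↥(B : Set (Fin d → ℤ)) → ℝ)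
    {x : Fin d → ℤ} (hx : x ∉ B) : extendZero B g x = 0 :=
  Function.extend_apply' _ _ _ fun ⟨y, hy⟩ => hx (hy ▸ y.2)

theorem theta_mul_dirichletRestrict (B : Finset (Fin d → ℤ)) {θ : (Fin d → ℤ) → ℝ}
    (hθ : ∀ x, 0 < θ x) (lam : ℝ) (χ : (Fin d → ℤ) → ℝ) (g : ↥(B : Set (Fin d → ℤ)) → ℝ)
    (x : ↥(B : Set (Fin d → ℤ))) :
    θ x * dirichletRestrict (B : Set (Fin d → ℤ)) (-(generator c θ - lam • mulOp χ)) g x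
      = ∑ y ∈ nbrs x.1, cond c x y * (extendZero B g x - extendZero B g y)
        + lam * (θ x * χ x * extendZero B g x) := by
  have h : dirichletRestrict (B : Set (Fin d → ℤ)) (-(generator c θ - lam • mulOp χ)) g x
      = -((θ x)⁻¹ * ∑ y ∈ nbrs x.1, cond c x y * (extendZero B g y - extendZero B g x)
        - lam * (χ x * extendZero B g x)) := rfl
  have h2 : ∑ y ∈ nbrs x.1, cond c x y * (extendZero B g x - extendZero B g y)
      = -∑ y ∈ nbrs x.1, cond c x y * (extendZero B g y - extendZero B g x) := by
    rw [← Finset.sum_neg_distrib]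
    exact Finset.sum_congr rfl fun y _ => by ring
  have h3 := mul_inv_cancel₀ (hθ x).ne'
  rw [h, h2]
  linear_combination (-∑ y ∈ nbrs x.1, cond c x y * (extendZero B g y - extendZero B g x)) * h3

/-- The quadratic form of the Dirichlet operator. -/
theorem sum_theta_mul_dirichletRestrict {B Λ : Finset (Fin d → ℤ)} (hB : B ⊆ Λ)
    (hΛ : ∀ x ∈ B, nbrs x ⊆ Λ) {θ : (Fin d → ℤ) → ℝ} (hθ : ∀ x, 0 < θ x) (lam : ℝ)
    (χ : (Fin d → ℤ) → ℝ) (g h : ↥(B : Set (Fin d → ℤ)) → ℝ) :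
    ∑ x : ↥(B : Set (Fin d → ℤ)), θ x *
        (dirichletRestrict (B : Set (Fin d → ℤ)) (-(generator c θ - lam • mulOp χ)) g x * h x)
      = 1 / 2 * ∑ x ∈ Λ, ∑ y ∈ Λ, cond c x y *
          ((extendZero B g x - extendZero B g y) * (extendZero B h x - extendZero B h y))
        + lam * ∑ x ∈ B, θ x * χ x * (extendZero B g x * extendZero B h x) := by
  rw [← sum_mul_sum_nbrs hB hΛ _ fun x hx => extendZero_of_notMem h hx, Finset.mul_sum,
    ← Finset.sum_add_distrib, ← Finset.sum_coe_sort B]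
  refine Finset.sum_congr rfl fun x _ => ?_
  rw [← mul_assoc, theta_mul_dirichletRestrict B hθ, ← extendZero_apply B h x]
  ring

theorem le_principalEigenvalue {B Λ : Finset (Fin d → ℤ)} (hBne : B.Nonempty) (hB : B ⊆ Λ)
    (hΛ : ∀ x ∈ B, nbrs x ⊆ Λ) {θ : (Fin d → ℤ) → ℝ} (hθ : ∀ x, 0 < θ x) (lam : ℝ)
    (χ : (Fin d → ℤ) → ℝ) {κ : ℝ}
    (hκ : ∀ f : (Fin d → ℤ) → ℝ, (∀ x ∉ B, f x = 0) → κ * ∑ x ∈ B, θ x * f x ^ 2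
      ≤ 1 / 2 * ∑ x ∈ Λ, localEnergy c Λ f x + lam * ∑ x ∈ B, θ x * χ x * f x ^ 2) :
    κ ≤ principalEigenvalue (B : Set (Fin d → ℤ)) (-(generator c θ - lam • mulOp χ)) := by
  have : Nonempty ↥(B : Set (Fin d → ℤ)) := by
    obtain ⟨x, hx⟩ := hBne
    exact ⟨⟨x, hx⟩⟩
  -- The infimum of an empty set of reals is `0` by convention, so an eigenvalue must be exhibited
  -- before any can be bounded. Each eigenvalue is then compared with `κ` through the quadratic form
  -- at its eigenvector.
  refine le_csInf ?_ fun μ hμ => ?_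
  · refine exists_hasEigenvalue_of_weighted_symm _ (w := fun x => θ x) (fun x => hθ x)
      fun g h => ?_
    have h1 := sum_theta_mul_dirichletRestrict (c := c) hB hΛ hθ lam χ g h
    have h2 := sum_theta_mul_dirichletRestrict (c := c) hB hΛ hθ lam χ h g
    have h3 : ∀ x, ∀ a b : ℝ, θ x * (a * b) = θ x * (b * a) := fun x a b => by ring
    simp only [h3 _ (g _)]
    rw [h1, h2]
    simp only [mul_comm (extendZero B g _), mul_comm (extendZero B g _ - extendZero B g _)]
  · obtain ⟨g, hg⟩ := Module.End.HasEigenvalue.exists_hasEigenvector hμ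
    have h1 := sum_theta_mul_dirichletRestrict (c := c) hB hΛ hθ lam χ g g
    rw [hg.apply_eq_smul] at h1
    have h2 := hκ (extendZero B g) fun x hx => extendZero_of_notMem g hx
    have h3 : ∑ x : ↥(B : Set (Fin d → ℤ)), θ x * ((μ • g) x * g x)
        = μ * ∑ x ∈ B, θ x * extendZero B g x ^ 2 := by
      rw [← Finset.sum_coe_sort B, Finset.mul_sum]
      refine Finset.sum_congr rfl fun x _ => ?_
      rw [extendZero_apply B g x, Pi.smul_apply, smul_eq_mul]
      ring
    have h4 : κ * ∑ x ∈ B, θ x * extendZero B g x ^ 2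
        ≤ μ * ∑ x ∈ B, θ x * extendZero B g x ^ 2 := by
      rw [← h3, h1]
      simpa only [localEnergy, sq] using h2
    refine le_of_mul_le_mul_right h4 ?_
    obtain ⟨x, hx⟩ := Function.ne_iff.1 hg.2
    refine Finset.sum_pos' (fun y _ => mul_nonneg (hθ y).le (sq_nonneg _)) ⟨x, x.2, ?_⟩
    rw [extendZero_apply]
    exact mul_pos (hθ x) (sq_pos_of_ne_zero hx)

end Dirichlet

/-! ### Matching holes with the infinite cluster -/

section Matching

variable {d : ℕ} {c : Edge d → ℝ}

/-- Every line in direction `i₀` is cut into segments of length `m` starting at multiples of `m`. In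
each segment the holes are at most half of the sites, so they inject into the cluster sites of the
same segment. -/
theorem exists_matching {ξ : ℝ} {i₀ : Fin d} {m n : ℕ} (hm : 0 < m)
    (h : DensityGood c ξ i₀ m (n + m)) :
    ∃ φ : (Fin d → ℤ) → (Fin d → ℤ),
      (∀ x ∈ box d n, x ∉ cluster c ξ → φ x ∈ cluster c ξ) ∧
      (∀ x ∈ box d n, x ∉ cluster c ξ → ∀ l, l ≠ i₀ → x l = φ x l) ∧
      (∀ x ∈ box d n, x ∉ cluster c ξ → |x i₀ - φ x i₀| ≤ m) ∧
      Set.InjOn φ {x | x ∈ box d n ∧ x ∉ cluster c ξ} := by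
  classical
  have hm' : (0 : ℤ) < m := by exact_mod_cast hm
  have hψ : ∀ b : Fin d → ℤ, ∃ ψ : ℕ → ℕ, b ∈ box d (n + m) →
      (∀ t < m, b + Pi.single i₀ (t : ℤ) ∉ cluster c ξ →
        ψ t < m ∧ b + Pi.single i₀ (ψ t : ℤ) ∈ cluster c ξ) ∧
      Set.InjOn ψ {t | t < m ∧ b + Pi.single i₀ (t : ℤ) ∉ cluster c ξ} := by
    intro b
    by_cases hb : b ∈ box d (n + m)
    · have h1 := h b hb
      have h2 := Finset.card_filter_add_card_filter_not (s := Finset.range m)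
        fun t : ℕ => b + Pi.single i₀ (t : ℤ) ∈ cluster c ξ
      rw [Finset.card_range] at h2
      set H := (Finset.range m).filter fun t : ℕ => b + Pi.single i₀ (t : ℤ) ∉ cluster c ξ
      set C := (Finset.range m).filter fun t : ℕ => b + Pi.single i₀ (t : ℤ) ∈ cluster c ξ
      obtain ⟨ψ, hψ1, hψ2⟩ := Set.Finite.exists_injOn_of_encard_le (s := (H : Set ℕ))
        (t := (C : Set ℕ)) H.finite_toSet (by
          rw [Set.encard_coe_eq_coe_finsetCard, Set.encard_coe_eq_coe_finsetCard]
          exact_mod_cast (by omega : H.card ≤ C.card))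
      refine ⟨ψ, fun _ => ⟨fun t ht htC => ?_, fun t ht t' ht' htt' => hψ2 ?_ ?_ htt'⟩⟩
      · have := hψ1 (show t ∈ (H : Set ℕ) by simp [H, ht, htC])
        simpa [C] using this
      · simpa [H] using ht
      · simpa [H] using ht'
    · exact ⟨id, fun h => absurd h hb⟩
  choose ψ hψ using hψ
  let base : (Fin d → ℤ) → (Fin d → ℤ) := fun x => x + Pi.single i₀ (-(x i₀ % m))
  let off : (Fin d → ℤ) → ℕ := fun x => (x i₀ % m).toNat
  have hoff : ∀ x, (off x : ℤ) = x i₀ % m := fun x =>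
    Int.toNat_of_nonneg (Int.emod_nonneg _ hm'.ne')
  have hofflt : ∀ x, off x < m := fun x => by
    have := Int.emod_lt_of_pos (x i₀) hm'; have := hoff x; omega
  have hbase : ∀ x, base x + Pi.single i₀ (off x : ℤ) = x := fun x => by
    simp only [base]
    rw [hoff, add_assoc, ← Pi.single_add]; simp
  have hbase₀ : ∀ x, base x i₀ = m * (x i₀ / m) := fun x => by
    have := Int.mul_ediv_add_emod (x i₀) m
    simp [base]; linarith
  have hbase' : ∀ x, ∀ l, l ≠ i₀ → base x l = x l := fun x l hl => by simp [base, hl]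
  have hbox : ∀ x ∈ box d n, base x ∈ box d (n + m) := fun x hx => by
    refine add_single_mem_box hx ?_
    rw [abs_neg, ← hoff, Nat.abs_cast]
    exact_mod_cast (hofflt x).le
  have key : ∀ x ∈ box d n, x ∉ cluster c ξ → ψ (base x) (off x) < m ∧
      base x + Pi.single i₀ (ψ (base x) (off x) : ℤ) ∈ cluster c ξ := fun x hx hxC =>
    (hψ (base x) (hbox x hx)).1 (off x) (hofflt x) (by rwa [hbase])
  refine ⟨fun x => base x + Pi.single i₀ (ψ (base x) (off x) : ℤ),
    fun x hx hxC => (key x hx hxC).2, fun x _ _ l hl => by simp [hbase' x l hl, hl],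
    fun x hx hxC => ?_, ?_⟩
  · have h1 := (key x hx hxC).1
    have h2 := hbase₀ x
    have h3 := hoff x
    have h4 := hofflt x
    have h5 := Int.mul_ediv_add_emod (x i₀) m
    simp only [Pi.add_apply, Pi.single_eq_same]
    rw [abs_le]
    omega
  · rintro x ⟨hx, hxC⟩ y ⟨hy, hyC⟩ hxy
    simp only at hxy
    -- The quotient by `m` identifies the segment, and `φ` preserves it; injectivity thus reduces to
    -- a single segment.
    have hdiv : ∀ z ∈ box d n, z ∉ cluster c ξ →
        (base z + Pi.single i₀ (ψ (base z) (off z) : ℤ) : Fin d → ℤ) i₀ / m = z i₀ / m := fun z hz hzC => by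
      simp only [Pi.add_apply, Pi.single_eq_same]
      have h0 : (ψ (base z) (off z) : ℤ) / m = 0 :=
        Int.ediv_eq_zero_of_lt (by positivity) (by exact_mod_cast (key z hz hzC).1)
      rw [hbase₀, Int.mul_add_ediv_left _ _ hm'.ne', h0, add_zero]
    have hb : base x = base y := by
      funext l
      by_cases hl : l = i₀
      · subst hl
        rw [hbase₀, hbase₀, ← hdiv x hx hxC, ← hdiv y hy hyC, hxy]
      · have := congrFun hxy l
        simpa [hl] using this
    have ho : off x = off y := by
      rw [← hb] at hxy
      have := congrFun hxy i₀
      simp only [Pi.add_apply, Pi.single_eq_same, add_right_inj, Nat.cast_inj] at this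
      refine (hψ (base x) (hbox x hx)).2 ⟨hofflt x, by rwa [hbase]⟩ ⟨hofflt y, ?_⟩ this
      rwa [hb, hbase]
    rw [← hbase x, ← hbase y, hb, ho]

theorem nbrs_subset_box {n n' : ℕ} (h : n + 1 ≤ n') {x : Fin d → ℤ} (hx : x ∈ box d n) :
    nbrs x ⊆ box d n' := fun y hy =>
  mem_box_of_abs_sub_le (r := 1) hx
    (fun l => by exact_mod_cast abs_sub_le_one_of_adj (mem_nbrs.1 hy) l) h

/-- Lower bounds on both principal eigenvalues from density of the infinite cluster and short walks
along bonds of conductance at least `u`. -/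
theorem le_eigenvalues (hc : ∀ e, 0 ≤ c e) {θ : (Fin d → ℤ) → ℝ} (hθ0 : ∀ x, 0 < θ x)
    (hθ : ∀ x, θ x ≤ 2 * d) {u : ℝ} (hu : 0 < u) (hu1 : u ≤ 1) {L : ℕ} (hL : 1 ≤ L)
    {ξ : ℝ} {A : ℝ} (hA : ∀ x, ∀ z ∈ cluster c ξ, 2 * θ x ≤ A * θ z) {i₀ : Fin d} {m n : ℕ}
    (hm : 0 < m) (hdens : DensityGood c ξ i₀ m (n + m))
    (hnear : ∀ x ∈ box d (n + m), ∀ z ∈ box d (n + m), z ∈ cluster c ξ →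
      (∀ l, l ≠ i₀ → x l = z l) → |x i₀ - z i₀| ≤ m →
      ∃ y, (y = x ∨ (lattice d).Adj x y ∧ θ x ≤ 2 * d * cond c x y) ∧
        Near (openGraph c u) L y z)
    {κ lam : ℝ} (hκ0 : 0 ≤ κ) (hκ : κ * (32 * d * L ^ 2 * (2 * L + 3) ^ d / u) ≤ 1)
    (hlam : κ * (1 + A) ≤ lam) :
    κ ≤ boxEigenvalue c θ ξ lam n ∧
      ((holes c ξ n).Nonempty → κ ≤ holesEigenvalue c θ ξ n) := by
  classical
  obtain ⟨φ, hφC, hφl, hφ₀, hφ⟩ := exists_matching hm hdens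
  set B := box d n with hB
  set Λ := box d (n + (L + 2)) with hΛ
  have hBΛ : B ⊆ Λ := box_subset (by omega)
  have hcube : ∀ x ∈ B, cube x (L + 2) ⊆ Λ := fun x hx y hy =>
    mem_box_of_abs_sub_le hx (mem_cube.1 hy) le_rfl
  have hnbrs : ∀ x ∈ B, nbrs x ⊆ Λ := fun x hx => nbrs_subset_box (by omega) hx
  have hE : ∀ f, 0 ≤ 1 / 2 * ∑ a ∈ Λ, localEnergy c Λ f a := fun f =>
    mul_nonneg (by norm_num) (Finset.sum_nonneg fun _ _ => localEnergy_nonneg hc _ _ _)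
  have hφB : ∀ x ∈ B, x ∉ cluster c ξ → φ x ∈ box d (n + m) := fun x hx hxC =>
    mem_box_of_abs_sub_le hx (fun l => by
      by_cases hl : l = i₀
      · subst hl; exact hφ₀ x hx hxC
      · rw [hφl x hx hxC l hl]; simp) le_rfl
  have main : ∀ f : (Fin d → ℤ) → ℝ, (∀ x ∉ B, f x = 0) → κ * ∑ x ∈ B, θ x * f x ^ 2
      ≤ κ * (1 + A) * ∑ x ∈ B.filter (· ∈ cluster c ξ), θ x * f x ^ 2
        + 1 / 2 * ∑ a ∈ Λ, localEnergy c Λ f a := by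
    intro f hf
    have h1 := sum_sq_le_of_matching hc (fun x => (hθ0 x).le) hθ hu hu1 hL hcube hA φ hφC hφ
      (fun x hx hxC => hnear x (box_subset (by omega) hx) _ (hφB x hx hxC) (hφC x hx hxC)
        (hφl x hx hxC) (hφ₀ x hx hxC)) hf
    refine (mul_le_mul_of_nonneg_left h1 hκ0).trans ?_
    have h2 := mul_le_mul_of_nonneg_right hκ (hE f)
    rw [mul_add, ← mul_assoc, ← mul_assoc]
    linarith
  constructor
  · refine le_principalEigenvalue (Λ := Λ) ⟨0, by simp [B, box, Pi.le_def]⟩ hBΛ hnbrs hθ0 lam _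
      fun f hf => (main f hf).trans ?_
    have h1 : ∑ x ∈ B, θ x * (cluster c ξ).indicator (fun _ => (1 : ℝ)) x * f x ^ 2
        = ∑ x ∈ B.filter (· ∈ cluster c ξ), θ x * f x ^ 2 := by
      rw [Finset.sum_filter]
      refine Finset.sum_congr rfl fun x _ => ?_
      by_cases hx : x ∈ cluster c ξ <;> simp [hx]
    rw [h1, add_comm]
    refine add_le_add le_rfl (mul_le_mul_of_nonneg_right hlam ?_)
    exact Finset.sum_nonneg fun x _ => mul_nonneg (hθ0 x).le (sq_nonneg _)
  · intro hne
    set H := B.filter (· ∉ cluster c ξ) with hH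
    have hcoe : holes c ξ n = (H : Set (Fin d → ℤ)) := by
      ext x; simp [holes, H, B]
    have hHB : H ⊆ B := Finset.filter_subset _ _
    -- Functions supported in the holes have no cluster mass, so the same inequality applies with no
    -- killing term.
    rw [holesEigenvalue, hcoe, show -(generator c θ)
      = -(generator c θ - (0 : ℝ) • mulOp (0 : (Fin d → ℤ) → ℝ)) by rw [zero_smul, sub_zero]]
    refine le_principalEigenvalue (Λ := Λ) ?_ (hHB.trans hBΛ) (fun x hx => hnbrs x (hHB hx)) hθ0
      0 _ fun f hf => ?_
    · rw [hcoe] at hne; exact_mod_cast hne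
    · have h1 := main f fun x hx => hf x fun h => hx (hHB h)
      have h2 : ∑ x ∈ B.filter (· ∈ cluster c ξ), θ x * f x ^ 2 = 0 :=
        Finset.sum_eq_zero fun x hx => by
          rw [hf x fun h => (Finset.mem_filter.1 h).2 (Finset.mem_filter.1 hx).2]; ring
      have h3 : ∑ x ∈ H, θ x * f x ^ 2 = ∑ x ∈ B, θ x * f x ^ 2 :=
        Finset.sum_subset hHB fun x _ hx => by rw [hf x hx]; ring
      rw [h2, mul_zero, zero_add] at h1
      rw [h3, zero_mul, add_zero]
      exact h1

theorem SiteGood.near {u : ℝ} {i₀ i₁ : Fin d} (hi : i₁ ≠ i₀) {K M m n : ℕ}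
    (hM : m + K + 4 ≤ M) (hsite : SiteGood c u (K + 2) n)
    (hline : LineGood c u i₀ K M n) (hslab : SlabGood c u i₀ (K + 2) n)
    {x z : Fin d → ℤ} (hx : x ∈ box d n) (hz : z ∈ box d n)
    (hxz : ∀ l, l ≠ i₀ → x l = z l) (hxz₀ : |x i₀ - z i₀| ≤ m) :
    Near (openGraph c u) ((2 * d + 9) * M) x z :=
  (near_of_hasRay (m := m) hi hM hline hslab hx hz (hsite x hx) (hsite z hz)
    (fun l hl => by rw [hxz l hl]; simp) (hxz₀.trans (by omega))).mono
    (Nat.mul_le_mul_right _ (by omega))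

end Matching

/-! ### Dyadic scales -/

theorem summable_poly_mul_geometric (C : ℝ) (a : ℕ) {σ : ℝ} (h0 : 0 ≤ σ) (h1 : σ < 1) :
    Summable fun k : ℕ => C * ((k : ℝ) + 1) ^ a * σ ^ k := by
  have h := summable_pow_mul_geometric_of_norm_lt_one (R := ℝ) a
    (by rwa [Real.norm_of_nonneg h0] : ‖σ‖ < 1)
  have hz : Summable fun k : ℕ => ((k : ℝ) + 1) ^ a * σ ^ k := by
    rcases h0.eq_or_lt with rfl | hpos
    · exact summable_of_ne_finset_zero (s := {0}) fun k hk => by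
        rw [zero_pow (by simpa using hk), mul_zero]
    · have h2 := ((summable_nat_add_iff 1).2 h).mul_left σ⁻¹
      refine h2.congr fun k => ?_
      push_cast
      rw [pow_succ]
      field_simp
  exact (hz.mul_left C).congr fun k => by ring

theorem eventually_poly_mul_geometric_le (C : ℝ) (a : ℕ) {σ ε : ℝ} (h0 : 0 ≤ σ) (h1 : σ < 1)
    (hε : 0 < ε) : ∀ᶠ k : ℕ in atTop, C * ((k : ℝ) + 1) ^ a * σ ^ k ≤ ε :=
  (summable_poly_mul_geometric C a h0 h1).tendsto_atTop_zero.eventually_le_const hε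

theorem ae_eventually_of_poly_mul_geometric {Ω : Type u} [MeasurableSpace Ω] {P : Measure Ω}
    {p : ℕ → Ω → Prop} {C : ℝ} {a : ℕ} {σ : ℝ} (h0 : 0 ≤ σ) (h1 : σ < 1)
    (h : ∀ᶠ k : ℕ in atTop,
      P {w | ¬ p k w} ≤ ENNReal.ofReal (C * ((k : ℝ) + 1) ^ a * σ ^ k)) :
    ∀ᵐ w ∂P, ∀ᶠ k in atTop, p k w := by
  obtain ⟨k₀, hk₀⟩ := eventually_atTop.1 h
  -- The probability bound holds only from `k₀` on; earlier events are replaced by `∅` to keep the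
  -- series summable.
  have hsum : ∑' k, P (if k₀ ≤ k then {w | ¬ p k w} else ∅) ≠ ⊤ := by
    refine ne_top_of_le_ne_top (summable_poly_mul_geometric C a h0 h1).tsum_ofReal_ne_top
      (ENNReal.tsum_le_tsum fun k => ?_)
    split_ifs with hk
    · exact hk₀ k hk
    · simp
  filter_upwards [ae_eventually_notMem hsum] with w hw
  filter_upwards [hw, eventually_ge_atTop k₀] with k hk hkk
  by_contra hcon
  exact hk (by rw [if_pos hkk]; exact hcon)

/-- The length of the segments used at the dyadic scale `2 ^ k`. -/
def segLen (d k : ℕ) : ℕ := (2 * ((d + 1) * k) + 1) * ((d + 1) * k)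

/-- The length of the lines used at the dyadic scale `2 ^ k`. -/
def lineLen (d K k : ℕ) : ℕ := segLen d k + K + 4

theorem segLen_le (d k : ℕ) : segLen d k ≤ 3 * (d + 1) ^ 2 * (k + 1) ^ 2 := by
  rw [segLen]
  calc _ ≤ (3 * ((d + 1) * (k + 1))) * ((d + 1) * (k + 1)) := by
        refine Nat.mul_le_mul ?_ ?_ <;> nlinarith
    _ = _ := by ring

theorem two_mul_lineLen_le (d K k : ℕ) :
    2 * lineLen d K k + 3 ≤ (6 * (d + 1) ^ 2 + 2 * K + 11) * (k + 1) ^ 2 := by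
  have h1 := segLen_le d k
  have h2 : 1 ≤ (k + 1) ^ 2 := Nat.one_le_pow _ _ (Nat.succ_pos k)
  rw [lineLen]
  nlinarith

theorem eventually_segLen_le (d : ℕ) : ∀ᶠ k in atTop, segLen d k + 1 ≤ 2 ^ k := by
  filter_upwards [eventually_poly_mul_geometric_le (3 * (d + 1) ^ 2 + 1) 2
    (σ := 1 / 2) (by norm_num) (by norm_num) one_pos] with k hk
  have h1 : ((segLen d k : ℕ) : ℝ) ≤ 3 * (d + 1) ^ 2 * ((k : ℝ) + 1) ^ 2 := by
    exact_mod_cast segLen_le d k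
  have h2 : (1 : ℝ) ≤ ((k : ℝ) + 1) ^ 2 := one_le_pow₀ (by linarith [Nat.cast_nonneg (α := ℝ) k])
  have h3 : (3 * (d + 1) ^ 2 + 1) * ((k : ℝ) + 1) ^ 2 ≤ 2 ^ k := by
    rw [one_div, inv_pow, ← div_eq_mul_inv, div_le_one (by positivity)] at hk
    exact hk
  have h4 : ((segLen d k : ℕ) : ℝ) + 1 ≤ 2 ^ k := by linarith
  exact_mod_cast h4

/-- With `ρ = 2 ^ (-βγ)` there are of order `2 ^ (dk)` sites, each bad with probability at most
`(poly(k) ρ ^ k) ^ D`. The series converges when `2 ^ d * ρ ^ D < 1`. -/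
theorem boxes_bound {d D t K k : ℕ} {q : ENNReal} {ρ : ℝ} (hρ : 0 ≤ ρ)
    (hq : q ≤ ENNReal.ofReal (2 * ρ ^ k)) :
    ((box d (4 * 2 ^ k)).card * t : ℕ) * ((d * (2 * lineLen d K k + 1) ^ d : ℕ) * q) ^ D
      ≤ ENNReal.ofReal (t * 9 ^ d * (2 * d * (6 * (d + 1) ^ 2 + 2 * K + 11) ^ d) ^ D
        * ((k : ℝ) + 1) ^ (2 * d * D) * (2 ^ d * ρ ^ D) ^ k) := by
  have hcard : ((box d (4 * 2 ^ k)).card : ℝ) ≤ 9 ^ d * (2 ^ d) ^ k := by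
    rw [card_box]
    have h1 : (2 * (4 * 2 ^ k) + 1) ^ d ≤ (9 * 2 ^ k) ^ d :=
      Nat.pow_le_pow_left (by have := Nat.one_le_two_pow (n := k); omega) d
    calc _ ≤ (((9 * 2 ^ k) ^ d : ℕ) : ℝ) := by exact_mod_cast h1
      _ = 9 ^ d * (2 ^ d) ^ k := by push_cast; rw [mul_pow, pow_right_comm]
  have hV : ((d * (2 * lineLen d K k + 1) ^ d : ℕ) : ℝ)
      ≤ d * (6 * (d + 1) ^ 2 + 2 * K + 11) ^ d * ((k : ℝ) + 1) ^ (2 * d) := by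
    have h1 : d * (2 * lineLen d K k + 1) ^ d
        ≤ d * ((6 * (d + 1) ^ 2 + 2 * K + 11) * (k + 1) ^ 2) ^ d :=
      Nat.mul_le_mul_left _ (Nat.pow_le_pow_left (by
        have := two_mul_lineLen_le d K k; omega) d)
    calc _ ≤ ((d * ((6 * (d + 1) ^ 2 + 2 * K + 11) * (k + 1) ^ 2) ^ d : ℕ) : ℝ) := by
          exact_mod_cast h1
      _ = _ := by push_cast; rw [mul_pow, ← pow_mul]; ring
  calc _ ≤ ((box d (4 * 2 ^ k)).card * t : ℕ)
        * ((d * (2 * lineLen d K k + 1) ^ d : ℕ) * ENNReal.ofReal (2 * ρ ^ k)) ^ D := by gcongr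
    _ = ENNReal.ofReal (((box d (4 * 2 ^ k)).card * t : ℕ)
        * ((d * (2 * lineLen d K k + 1) ^ d : ℕ) * (2 * ρ ^ k)) ^ D) := by
        rw [ENNReal.ofReal_mul (Nat.cast_nonneg _), ENNReal.ofReal_natCast,
          ENNReal.ofReal_pow (by positivity), ENNReal.ofReal_mul (Nat.cast_nonneg _),
          ENNReal.ofReal_natCast]
    _ ≤ _ := by
        refine ENNReal.ofReal_le_ofReal ?_
        rw [Nat.cast_mul]
        calc _ ≤ 9 ^ d * (2 ^ d) ^ k * t * (d * (6 * (d + 1) ^ 2 + 2 * K + 11) ^ d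
                * ((k : ℝ) + 1) ^ (2 * d) * (2 * ρ ^ k)) ^ D := by gcongr
          _ = _ := by simp only [mul_pow, ← pow_mul]; ring

/-- The choice `r = (d + 1) k` lets `2 ^ (-r)` beat the volume `2 ^ (dk)` with `2 ^ (-k)` to spare.
-/
theorem density_bound {d k : ℕ} (hk : segLen d k + 1 ≤ 2 ^ k) :
    ((box d (3 * 2 ^ k + segLen d k)).card * (2 * ((d + 1) * k) + 2) : ℕ)
        * (2⁻¹ : ENNReal) ^ ((d + 1) * k)
      ≤ ENNReal.ofReal (9 ^ d * (2 * (d + 1)) * ((k : ℝ) + 1) ^ 1 * (1 / 2) ^ k) := by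
  have h1 : (box d (3 * 2 ^ k + segLen d k)).card ≤ (9 * 2 ^ k) ^ d := by
    rw [card_box]
    exact Nat.pow_le_pow_left (by have := Nat.one_le_two_pow (n := k); omega) d
  have h2 : 2 * ((d + 1) * k) + 2 ≤ 2 * (d + 1) * (k + 1) := by nlinarith
  calc _ ≤ ((9 * 2 ^ k) ^ d * (2 * (d + 1) * (k + 1)) : ℕ)
        * (2⁻¹ : ENNReal) ^ ((d + 1) * k) := by gcongr
    _ = ENNReal.ofReal (((9 * 2 ^ k) ^ d * (2 * (d + 1) * (k + 1)) : ℕ)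
        * 2⁻¹ ^ ((d + 1) * k)) := by
        rw [ENNReal.ofReal_mul (Nat.cast_nonneg _), ENNReal.ofReal_natCast,
          ENNReal.ofReal_pow (by positivity), ENNReal.ofReal_inv_of_pos two_pos]
        simp
    _ = _ := by
        congr 1
        push_cast
        have h3 : ((2 : ℝ) ^ k) ^ d * 2⁻¹ ^ ((d + 1) * k) = (1 / 2) ^ k := by
          rw [add_mul, one_mul, pow_add, ← pow_mul, ← mul_assoc, mul_comm d k, ← mul_pow]
          norm_num
        rw [mul_pow, pow_one, ← h3]
        ring

theorem IsPolyTailEnvironment.ae_mem_Ioc {Ω : Type u} [MeasurableSpace Ω] {P : Measure Ω}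
    {d : ℕ} {γ : ℝ} {ω : Edge d → Ω → ℝ} (h : IsPolyTailEnvironment P γ ω) :
    ∀ᵐ w ∂P, ∀ e, ω e w ∈ Set.Ioc (0 : ℝ) 1 := by
  have : Countable (Edge d) := Subtype.countable
  exact ae_all_iff.2 h.mem_Ioc

theorem tendsto_scale {β : ℝ} (hβ : 0 < β) :
    Tendsto (fun k : ℕ => ((2 : ℝ) ^ (-β)) ^ k) atTop (𝓝 0) :=
  tendsto_pow_atTop_nhds_zero_of_lt_one (by positivity)
    (Real.rpow_lt_one_of_one_lt_of_neg one_lt_two (by linarith))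

section Environment

variable {Ω : Type u} [MeasurableSpace Ω] {P : Measure Ω} [IsProbabilityMeasure P] {d : ℕ}
  {γ : ℝ} {ω : Edge d → Ω → ℝ}

/-- The factor `2` absorbs the `1 + o(1)` of the tail assumption. -/
theorem IsPolyTailEnvironment.exists_tail_bound (h : IsPolyTailEnvironment P γ ω) (e : Edge d) :
    ∃ u₀ > 0, ∀ u : ℝ, 0 < u → u < u₀ → P {w | ω e w < u} ≤ ENNReal.ofReal (2 * u ^ γ) := by
  have h1 := (h.tail e).eventually_lt_const (by norm_num : (1 : ℝ) < 2)
  obtain ⟨u₀, hu₀, hsub⟩ := mem_nhdsGT_iff_exists_Ioo_subset.1 h1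
  refine ⟨u₀, hu₀, fun u hu huu => ?_⟩
  have h2 : P.real {w | ω e w ≤ u} / u ^ γ < 2 := hsub ⟨hu, huu⟩
  rw [div_lt_iff₀ (Real.rpow_pos_of_pos hu γ)] at h2
  calc P {w | ω e w < u} ≤ P {w | ω e w ≤ u} := measure_mono fun w (hw : ω e w < u) => hw.le
    _ = ENNReal.ofReal (P.real {w | ω e w ≤ u}) := by rw [ofReal_measureReal]
    _ ≤ _ := ENNReal.ofReal_le_ofReal h2.le

/-- This fixes the threshold `ξ₀`, from the law of one conductance alone: closed bonds must be rare
enough for the contour count. -/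
theorem IsPolyTailEnvironment.exists_small (h : IsPolyTailEnvironment P γ ω) (hγ : 0 < γ)
    (e : Edge d) : ∃ ξ₀ > 0, ∀ ξ : ℝ, 0 < ξ → ξ < ξ₀ → P {w | ω e w < ξ} ≤ 1 / 64 := by
  obtain ⟨u₀, hu₀, hu⟩ := h.exists_tail_bound e
  have hlim : Tendsto (fun ξ : ℝ => 2 * ξ ^ γ) (𝓝[>] 0) (𝓝 0) := by
    have := ((Real.continuousAt_rpow_const 0 γ (Or.inr hγ.le)).tendsto.const_mul 2).mono_left
      (nhdsWithin_le_nhds (s := Set.Ioi 0))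
    simpa [Real.zero_rpow hγ.ne'] using this
  obtain ⟨ξ₁, hξ₁, hsub⟩ := mem_nhdsGT_iff_exists_Ioo_subset.1
    (hlim.eventually_lt_const (by norm_num : (0 : ℝ) < 1 / 64))
  refine ⟨min u₀ ξ₁, lt_min hu₀ hξ₁, fun ξ h0 h1 => ?_⟩
  refine (hu ξ h0 (h1.trans_le (min_le_left _ _))).trans ?_
  have h2 : 2 * ξ ^ γ < 1 / 64 := hsub ⟨h0, h1.trans_le (min_le_right _ _)⟩
  calc _ ≤ ENNReal.ofReal (1 / 64) := ENNReal.ofReal_le_ofReal h2.le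
    _ = 1 / 64 := by
      rw [ENNReal.ofReal_div_of_pos (by norm_num)]; simp

theorem two_pow_mul_lt_one {d D : ℕ} {β γ : ℝ} (h : d < β * γ * D) :
    (2 : ℝ) ^ d * (((2 : ℝ) ^ (-β)) ^ γ) ^ D < 1 := by
  rw [← Real.rpow_natCast 2 d, ← Real.rpow_mul two_pos.le, ← Real.rpow_natCast _ D,
    ← Real.rpow_mul two_pos.le, ← Real.rpow_add two_pos]
  exact Real.rpow_lt_one_of_one_lt_of_neg one_lt_two (by linarith)

/-- A box condition that fails in a box of radius `4 * 2 ^ k` with probability at most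
`card * (V q) ^ D` holds almost surely for all large `k`, if `d < β γ D`. -/
theorem IsPolyTailEnvironment.ae_eventually (h : IsPolyTailEnvironment P γ ω) (e : Edge d)
    {β : ℝ} (hβ : 0 < β) {D t K : ℕ} (hD : d < β * γ * D) {G : ℕ → (Edge d → ℝ) → ℝ → Prop}
    (hG : ∀ k u q, BondBound P ω u q → P {w | ¬ G k (fun e => ω e w) u}
      ≤ ((box d (4 * 2 ^ k)).card * t : ℕ) * ((d * (2 * lineLen d K k + 1) ^ d : ℕ) * q) ^ D) :
    ∀ᵐ w ∂P, ∀ᶠ k : ℕ in atTop, G k (fun e => ω e w) (((2 : ℝ) ^ (-β)) ^ k) := by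
  have hρ : (0 : ℝ) ≤ ((2 : ℝ) ^ (-β)) ^ γ := by positivity
  refine ae_eventually_of_poly_mul_geometric (by positivity) (two_pow_mul_lt_one hD) ?_
    (C := t * 9 ^ d * (2 * d * (6 * (d + 1) ^ 2 + 2 * K + 11) ^ d) ^ D) (a := 2 * d * D)
  obtain ⟨u₀, hu₀, hu⟩ := h.exists_tail_bound e
  filter_upwards [(tendsto_scale hβ).eventually_lt_const hu₀] with k hk
  refine (hG k _ _ (h.bondBound e _)).trans (boxes_bound hρ ?_)
  refine (hu _ (by positivity) hk).trans (le_of_eq ?_)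
  rw [Real.rpow_pow_comm (x := (2 : ℝ) ^ (-β)) (by positivity) γ k]

end Environment

/-! ### Eigenvalues on all large boxes -/

section Final

variable {d : ℕ} {c : Edge d → ℝ}

theorem lineLen_bound {d K k : ℕ} {β : ℝ} (hd : 0 < d) :
    32 * d * (((2 * d + 9) * lineLen d K k : ℕ) : ℝ) ^ 2
        * (2 * (((2 * d + 9) * lineLen d K k : ℕ) : ℝ) + 3) ^ d / ((2 : ℝ) ^ (-β)) ^ k
      ≤ 32 * d * ((2 * d + 9) * (6 * (d + 1) ^ 2 + 2 * K + 11)) ^ (d + 2)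
        * ((k : ℝ) + 1) ^ (2 * (d + 2)) * ((2 : ℝ) ^ β) ^ k := by
  set Q : ℝ := (2 * d + 9) * (6 * (d + 1) ^ 2 + 2 * K + 11) * ((k : ℝ) + 1) ^ 2 with hQ
  have h1 : 2 * (((2 * d + 9) * lineLen d K k : ℕ) : ℝ) + 3 ≤ Q := by
    have h := two_mul_lineLen_le d K k
    have : 2 * ((2 * d + 9) * lineLen d K k) + 3
        ≤ (2 * d + 9) * ((6 * (d + 1) ^ 2 + 2 * K + 11) * (k + 1) ^ 2) :=
      le_trans (by nlinarith) (Nat.mul_le_mul_left (2 * d + 9) h)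
    calc _ = ((2 * ((2 * d + 9) * lineLen d K k) + 3 : ℕ) : ℝ) := by push_cast; ring
      _ ≤ (((2 * d + 9) * ((6 * (d + 1) ^ 2 + 2 * K + 11) * (k + 1) ^ 2) : ℕ) : ℝ) := by
          exact_mod_cast this
      _ = Q := by rw [hQ]; push_cast; ring
  have h2 : (((2 * d + 9) * lineLen d K k : ℕ) : ℝ) ≤ Q := by
    have := Nat.cast_nonneg (α := ℝ) ((2 * d + 9) * lineLen d K k); linarith
  have hinv : (((2 : ℝ) ^ (-β)) ^ k)⁻¹ = ((2 : ℝ) ^ β) ^ k := by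
    rw [Real.rpow_neg two_pos.le, inv_pow, inv_inv]
  rw [div_eq_mul_inv, hinv]
  calc _ ≤ 32 * d * Q ^ 2 * Q ^ d * ((2 : ℝ) ^ β) ^ k := by gcongr
    _ = _ := by rw [hQ]; simp only [mul_pow, ← pow_mul]; ring

/-- Deterministic lower bounds on the principal eigenvalues from good events at all large dyadic
scales. -/
theorem eventually_le_eigenvalues (hd : 0 < d) (hc : ∀ e, 0 ≤ c e) {θ : (Fin d → ℤ) → ℝ}
    (hθ0 : ∀ x, 0 < θ x) (hθ : ∀ x, θ x ≤ 2 * d) {ξ A : ℝ}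
    (hA : ∀ x, ∀ z ∈ cluster c ξ, 2 * θ x ≤ A * θ z) {i₀ : Fin d} {K : ℕ} {α β : ℝ}
    (hβ : 0 < β) (hαβ : β < α)
    (hdens : ∀ᶠ k in atTop, DensityGood c ξ i₀ (segLen d k) (3 * 2 ^ k))
    (hnear : ∀ᶠ k in atTop, ∀ x ∈ box d (3 * 2 ^ k), ∀ z ∈ box d (3 * 2 ^ k), z ∈ cluster c ξ →
      (∀ l, l ≠ i₀ → x l = z l) → |x i₀ - z i₀| ≤ segLen d k →
      ∃ y, (y = x ∨ (lattice d).Adj x y ∧ θ x ≤ 2 * d * cond c x y) ∧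
        Near (openGraph c (((2 : ℝ) ^ (-β)) ^ k)) ((2 * d + 9) * lineLen d K k) y z) :
    ∀ᶠ n : ℕ in atTop, ∀ lam : ℝ, (1 + A) * (n : ℝ) ^ (-α) ≤ lam →
      (n : ℝ) ^ (-α) ≤ boxEigenvalue c θ ξ lam n ∧
        ((holes c ξ n).Nonempty → (n : ℝ) ^ (-α) ≤ holesEigenvalue c θ ξ n) := by
  have hsmall := eventually_poly_mul_geometric_le
    (2 ^ α * (32 * d * ((2 * d + 9) * (6 * (d + 1) ^ 2 + 2 * K + 11)) ^ (d + 2)))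
    (2 * (d + 2)) (σ := (2 : ℝ) ^ (β - α)) (by positivity)
    (Real.rpow_lt_one_of_one_lt_of_neg one_lt_two (by linarith)) one_pos
  obtain ⟨k₀, hk₀⟩ := eventually_atTop.1
    ((hdens.and hnear).and (hsmall.and ((eventually_segLen_le d).and (eventually_ge_atTop 1))))
  filter_upwards [eventually_ge_atTop (2 ^ k₀ + 1)] with n hn lam hlam
  have hn1 : 1 < n := lt_of_lt_of_le (by have := Nat.one_le_two_pow (n := k₀); omega) hn
  -- Then `n ≤ 2 ^ k ≤ 2 n`, and passing from the dyadic scale to `n` costs only the factor `2 ^ α`.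
  set k := Nat.clog 2 n with hk
  have hnk : n ≤ 2 ^ k := Nat.le_pow_clog one_lt_two n
  have hkn : 2 ^ k ≤ 2 * n := by
    have h1 := Nat.pow_pred_clog_lt_self one_lt_two hn1
    have h2 : 0 < k := Nat.clog_pos one_lt_two hn1
    have h3 : 2 ^ k = 2 * 2 ^ (k - 1) := by rw [← pow_succ', Nat.sub_add_cancel h2]
    rw [h3]
    exact Nat.mul_le_mul_left 2 h1.le
  have hkk : k₀ ≤ k := by
    have : 2 ^ k₀ < 2 ^ k := by omega
    exact ((Nat.pow_lt_pow_iff_right one_lt_two).1 this).le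
  obtain ⟨⟨hdens, hnear⟩, hsmall, hseg, hk1⟩ := hk₀ k hkk
  have hbox : box d (n + segLen d k) ⊆ box d (3 * 2 ^ k) := box_subset (by omega)
  have hu1 : ((2 : ℝ) ^ (-β)) ^ k ≤ 1 := pow_le_one₀ (by positivity)
    (Real.rpow_lt_one_of_one_lt_of_neg one_lt_two (by linarith)).le
  refine le_eigenvalues hc hθ0 hθ (u := ((2 : ℝ) ^ (-β)) ^ k) (by positivity) hu1
    (L := (2 * d + 9) * lineLen d K k) ?_ hA (i₀ := i₀) (m := segLen d k) ?_
    (fun x hx => hdens x (hbox hx)) (fun x hx z hz => hnear x (hbox hx) z (hbox hz))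
    (by positivity) ?_ (by rw [mul_comm]; exact hlam)
  · exact Nat.mul_pos (by omega) (by rw [lineLen]; omega)
  · exact Nat.mul_pos (Nat.succ_pos _) (Nat.mul_pos (Nat.succ_pos d) hk1)
  · have hnα : (n : ℝ) ^ (-α) ≤ 2 ^ α * ((2 : ℝ) ^ (-α)) ^ k := by
      have h1 : (2 : ℝ) ^ k / 2 ≤ n := by
        rw [div_le_iff₀ two_pos, mul_comm]; exact_mod_cast hkn
      calc (n : ℝ) ^ (-α) ≤ ((2 : ℝ) ^ k / 2) ^ (-α) :=
            Real.rpow_le_rpow_of_nonpos (by positivity) h1 (by linarith)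
        _ = _ := by
            rw [Real.div_rpow (by positivity) two_pos.le, Real.rpow_pow_comm two_pos.le,
              Real.rpow_neg two_pos.le, div_inv_eq_mul, mul_comm]
    have hW := lineLen_bound (d := d) (K := K) (k := k) (β := β) hd
    refine (mul_le_mul hnα hW (by positivity) (by positivity)).trans (le_trans (le_of_eq ?_) hsmall)
    have h2 : ((2 : ℝ) ^ (β - α)) ^ k = ((2 : ℝ) ^ (-α)) ^ k * ((2 : ℝ) ^ β) ^ k := by
      rw [← mul_pow, ← Real.rpow_add two_pos]; ring_nf
    rw [h2]; ring

theorem condMeasure_pos (hd : 0 < d) (hc : ∀ e, 0 < c e) (x : Fin d → ℤ) :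
    0 < condMeasure c x :=
  Finset.sum_pos (fun y hy => by rw [cond_eq (mem_nbrs.1 hy)]; exact hc _)
    ⟨_, mem_nbrs.2 (lattice_adj_add_single x ⟨0, hd⟩)⟩

theorem condMeasure_le (hc : ∀ e, c e ≤ 1) (x : Fin d → ℤ) : condMeasure c x ≤ 2 * d := by
  calc condMeasure c x ≤ (nbrs x).card * 1 := by
        rw [condMeasure, ← nsmul_eq_mul]
        exact Finset.sum_le_card_nsmul _ _ _ fun y _ => cond_le_one hc x y
    _ ≤ 2 * d := by rw [mul_one]; exact_mod_cast card_nbrs_le x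

theorem le_condMeasure_of_mem_cluster (hc : ∀ e, 0 ≤ c e) {ξ : ℝ} {z : Fin d → ℤ}
    (hz : z ∈ cluster c ξ) : ξ ≤ condMeasure c z := by
  obtain ⟨z', hzz'⟩ := exists_adj_of_mem_cluster hz
  exact (le_cond_of_openGraph_adj hzz').trans
    (Finset.single_le_sum (f := cond c z) (fun y _ => cond_nonneg hc z y)
      (mem_nbrs.2 hzz'.1))

end Final

/-! ### Almost sure good events and the two random walks. -/

section Main

variable {Ω : Type u} [MeasurableSpace Ω] {P : Measure Ω} [IsProbabilityMeasure P] {d : ℕ}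
  {γ : ℝ} {ω : Edge d → Ω → ℝ}

theorem IsPolyTailEnvironment.ae_eventually_lineGood (h : IsPolyTailEnvironment P γ ω)
    (i₀ : Fin d) {β : ℝ} (hβ : 0 < β) {K : ℕ} (hK : d < β * γ * K) :
    ∀ᵐ w ∂P, ∀ᶠ k : ℕ in atTop,
      LineGood (fun e => ω e w) (((2 : ℝ) ^ (-β)) ^ k) i₀ K (lineLen d K k) (4 * 2 ^ k) :=
  h.ae_eventually (Bond.edge (0, i₀)) hβ hK (t := d * 2) (K := K)
    (G := fun k c u => LineGood c u i₀ K (lineLen d K k) (4 * 2 ^ k))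
    fun _ _ _ hq => measure_not_lineGood_le hq i₀ _ _ _

theorem IsPolyTailEnvironment.ae_eventually_slabGood (h : IsPolyTailEnvironment P γ ω)
    (i₀ : Fin d) {β : ℝ} (hβ : 0 < β) {K : ℕ} (hK : d < β * γ * (K + 2 : ℕ)) :
    ∀ᵐ w ∂P, ∀ᶠ k : ℕ in atTop,
      SlabGood (fun e => ω e w) (((2 : ℝ) ^ (-β)) ^ k) i₀ (K + 2) (4 * 2 ^ k) :=
  h.ae_eventually (Bond.edge (0, i₀)) hβ hK (t := 2) (K := K)
    (G := fun k c u => SlabGood c u i₀ (K + 2) (4 * 2 ^ k))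
    fun _ _ _ hq => measure_not_slabGood_le hq i₀ (by rw [lineLen]; omega) _

theorem IsPolyTailEnvironment.ae_eventually_siteGood (h : IsPolyTailEnvironment P γ ω)
    (i₀ : Fin d) {β : ℝ} (hβ : 0 < β) {K : ℕ} (hD : d < β * γ * (2 * d : ℕ)) :
    ∀ᵐ w ∂P, ∀ᶠ k : ℕ in atTop,
      SiteGood (fun e => ω e w) (((2 : ℝ) ^ (-β)) ^ k) (K + 2) (4 * 2 ^ k) :=
  h.ae_eventually (Bond.edge (0, i₀)) hβ hD (t := 1) (K := K)
    (G := fun k c u => SiteGood c u (K + 2) (4 * 2 ^ k))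
    fun _ _ _ hq => by
      rw [mul_one]
      exact measure_not_siteGood_le hq (by rw [lineLen]; omega) _

theorem IsPolyTailEnvironment.ae_eventually_pairGood (h : IsPolyTailEnvironment P γ ω)
    (i₀ : Fin d) {β : ℝ} (hβ : 0 < β) {K : ℕ} (hD : d < β * γ * (4 * d - 2 : ℕ)) :
    ∀ᵐ w ∂P, ∀ᶠ k : ℕ in atTop,
      PairGood (fun e => ω e w) (((2 : ℝ) ^ (-β)) ^ k) (K + 2) (4 * 2 ^ k) :=
  h.ae_eventually (Bond.edge (0, i₀)) hβ hD (t := d) (K := K)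
    (G := fun k c u => PairGood c u (K + 2) (4 * 2 ^ k))
    fun _ _ _ hq => measure_not_pairGood_le hq (by rw [lineLen]; omega) _

theorem IsPolyTailEnvironment.ae_eventually_densityGood (h : IsPolyTailEnvironment P γ ω)
    {i₀ i₁ : Fin d} (hi : i₀ ≠ i₁) {ξ : ℝ} (hξ : P {w | ω (Bond.edge (0, i₀)) w < ξ} ≤ 1 / 64) :
    ∀ᵐ w ∂P, ∀ᶠ k : ℕ in atTop,
      DensityGood (fun e => ω e w) ξ i₀ (segLen d k) (3 * 2 ^ k) := by
  refine ae_eventually_of_poly_mul_geometric (σ := 1 / 2) (by norm_num) (by norm_num)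
    (C := 9 ^ d * (2 * (d + 1))) (a := 1) ?_
  filter_upwards [eventually_segLen_le d] with k hk
  exact (measure_not_densityGood_le (h.bondBound _ ξ) hξ hi _ _).trans (density_bound hk)

/-- Eigenvalue bounds for the constant speed random walk. -/
theorem IsPolyTailEnvironment.csrw (h : IsPolyTailEnvironment P γ ω) (hγ : 0 < γ)
    {i₀ i₁ : Fin d} (hi : i₀ ≠ i₁) {α β : ℝ} (hβ : 0 < β) (hαβ : β < α)
    (hD : d < β * γ * (4 * d - 2 : ℕ)) :
    ∃ ξ₀ : ℝ, 0 < ξ₀ ∧ ∀ ξ : ℝ, 0 < ξ → ξ < ξ₀ → ∀ᵐ w ∂P, ∀ᶠ n : ℕ in atTop,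
      (n : ℝ) ^ (-α) ≤ boxEigenvalue (fun e => ω e w) (condMeasure fun e => ω e w) ξ
        ((1 + 8 * (d : ℝ) / ξ) * (n : ℝ) ^ (-α)) n ∧
      ((holes (fun e => ω e w) ξ n).Nonempty →
        (n : ℝ) ^ (-α) ≤ holesEigenvalue (fun e => ω e w) (condMeasure fun e => ω e w) ξ n) := by
  obtain ⟨ξ₀, hξ₀, hξ⟩ := h.exists_small hγ (Bond.edge (0, i₀))
  refine ⟨ξ₀, hξ₀, fun ξ h0 h1 => ?_⟩
  -- This `K` makes lines and slabs work: `βγK > d`.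
  obtain ⟨K, hK⟩ := exists_nat_gt ((d : ℝ) / (β * γ))
  rw [div_lt_iff₀' (by positivity)] at hK
  have hK2 : (d : ℝ) < β * γ * (K + 2 : ℕ) := hK.trans_le
    (mul_le_mul_of_nonneg_left (by exact_mod_cast (by omega)) (by positivity))
  filter_upwards [h.ae_mem_Ioc, h.ae_eventually_lineGood i₀ hβ hK,
    h.ae_eventually_slabGood i₀ hβ hK2, h.ae_eventually_pairGood i₀ hβ (K := K) hD,
    h.ae_eventually_densityGood hi (hξ ξ h0 h1)] with w hw hline hslab hpair hdens
  have hc : ∀ e, 0 ≤ ω e w := fun e => (hw e).1.le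
  have hd : 0 < d := i₀.pos
  have hev := eventually_le_eigenvalues (c := fun e => ω e w) hd hc
    -- `A = 4d / ξ` comes from `π ≤ 2d` everywhere and `π ≥ ξ` on the cluster; the stated `8d / ξ`
    -- is larger than needed.
    (condMeasure_pos hd fun e => (hw e).1) (condMeasure_le fun e => (hw e).2)
    (ξ := ξ) (A := 4 * d / ξ) (fun x z hz => ?_) hβ hαβ hdens (K := K) ?_
  · filter_upwards [hev] with n hn
    refine hn _ (mul_le_mul_of_nonneg_right ?_ (by positivity))
    gcongr
    norm_num
  · have h2 := condMeasure_le (c := fun e => ω e w) (fun e => (hw e).2) x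
    have h3 := le_condMeasure_of_mem_cluster hc hz
    calc 2 * condMeasure (fun e => ω e w) x ≤ 4 * d / ξ * ξ := by
          rw [div_mul_cancel₀ _ h0.ne']; linarith
      _ ≤ _ := by gcongr
  · filter_upwards [hline, hslab, hpair, (tendsto_scale hβ).eventually_le_const h0]
      with k hline hslab hpair hu x hx z hz hzC hxz hxz₀
    -- The pair condition is used one step outside the box, whence the box conditions at `4 * 2 ^
    -- k`.
    have hb : box d (3 * 2 ^ k + 1) ⊆ box d (4 * 2 ^ k) :=
      box_subset (by have := Nat.one_le_two_pow (n := k); omega)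
    exact PairGood.near hi.symm hc le_rfl hu (fun x hx => hpair x (hb hx))
      (fun x hx => hline x (hb hx)) (fun x hx => hslab x (hb hx)) hx hz hzC hxz hxz₀

/-- Eigenvalue bounds for the variable speed random walk. -/
theorem IsPolyTailEnvironment.vsrw (h : IsPolyTailEnvironment P γ ω) (hγ : 0 < γ)
    {i₀ i₁ : Fin d} (hi : i₀ ≠ i₁) {α β : ℝ} (hβ : 0 < β) (hαβ : β < α)
    (hD : d < β * γ * (2 * d : ℕ)) :
    ∃ ξ₀ : ℝ, 0 < ξ₀ ∧ ∀ ξ : ℝ, 0 < ξ → ξ < ξ₀ → ∀ᵐ w ∂P, ∀ᶠ n : ℕ in atTop,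
      (n : ℝ) ^ (-α) ≤ boxEigenvalue (fun e => ω e w) unitMeasure ξ (3 * (n : ℝ) ^ (-α)) n ∧
      ((holes (fun e => ω e w) ξ n).Nonempty →
        (n : ℝ) ^ (-α) ≤ holesEigenvalue (fun e => ω e w) unitMeasure ξ n) := by
  obtain ⟨ξ₀, hξ₀, hξ⟩ := h.exists_small hγ (Bond.edge (0, i₀))
  refine ⟨ξ₀, hξ₀, fun ξ h0 h1 => ?_⟩
  obtain ⟨K, hK⟩ := exists_nat_gt ((d : ℝ) / (β * γ))
  rw [div_lt_iff₀' (by positivity)] at hK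
  have hK2 : (d : ℝ) < β * γ * (K + 2 : ℕ) := hK.trans_le
    (mul_le_mul_of_nonneg_left (by exact_mod_cast (by omega)) (by positivity))
  filter_upwards [h.ae_mem_Ioc, h.ae_eventually_lineGood i₀ hβ hK,
    h.ae_eventually_slabGood i₀ hβ hK2, h.ae_eventually_siteGood i₀ hβ (K := K) hD,
    h.ae_eventually_densityGood hi (hξ ξ h0 h1)] with w hw hline hslab hsite hdens
  have hd : 0 < d := i₀.pos
  have hd1 : (1 : ℝ) ≤ d := by exact_mod_cast hd
  have hev := eventually_le_eigenvalues (c := fun e => ω e w) hd (fun e => (hw e).1.le)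
    (θ := unitMeasure) (fun _ => one_pos) (fun _ => by rw [unitMeasure]; linarith)
    -- With `θ = 1` the value `A = 2` suffices, and `1 + A = 3` is the constant in `λ`.
    (ξ := ξ) (A := 2) (fun x z hz => by simp [unitMeasure]) hβ hαβ hdens (K := K) ?_
  · filter_upwards [hev] with n hn
    exact hn _ (by norm_num)
  · filter_upwards [hline, hslab, hsite] with k hline hslab hsite x hx z hz hzC hxz hxz₀
    have hb : box d (3 * 2 ^ k) ⊆ box d (4 * 2 ^ k) := box_subset (by omega)
    exact ⟨x, Or.inl rfl, SiteGood.near hi.symm le_rfl hsite hline hslab (hb hx) (hb hz) hxz hxz₀⟩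

end Main

end

end RCM

/-! ### Choice of the exponents. -/

theorem lemma5p1 (d : ℕ) (hd : 2 ≤ d) (γ : ℝ) :
    -- the constant speed random walk
    ((1 / 8 : ℝ) * ((d : ℝ) / ((d : ℝ) - 1 / 2)) < γ →
      ∃ α : ℝ, 0 < α ∧ α < 2 ∧
        ∀ (Ω : Type u) [MeasurableSpace Ω] (P : Measure Ω) [IsProbabilityMeasure P]
          (ω : RCM.Edge d → Ω → ℝ), RCM.IsPolyTailEnvironment P γ ω →
          ∃ ξ₀ : ℝ, 0 < ξ₀ ∧ ∀ ξ : ℝ, 0 < ξ → ξ < ξ₀ →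
            ∀ᵐ w ∂P, ∀ᶠ n : ℕ in atTop,
              (n : ℝ) ^ (-α) ≤ RCM.boxEigenvalue (fun e => ω e w)
                (RCM.condMeasure fun e => ω e w) ξ
                ((1 + 8 * (d : ℝ) / ξ) * (n : ℝ) ^ (-α)) n ∧
              ((RCM.holes (fun e => ω e w) ξ n).Nonempty →
                (n : ℝ) ^ (-α) ≤ RCM.holesEigenvalue (fun e => ω e w)
                  (RCM.condMeasure fun e => ω e w) ξ n)) ∧
    -- the variable speed random walk
    ((1 / 4 : ℝ) < γ →
      ∃ α : ℝ, 0 < α ∧ α < 2 ∧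
        ∀ (Ω : Type u) [MeasurableSpace Ω] (P : Measure Ω) [IsProbabilityMeasure P]
          (ω : RCM.Edge d → Ω → ℝ), RCM.IsPolyTailEnvironment P γ ω →
          ∃ ξ₀ : ℝ, 0 < ξ₀ ∧ ∀ ξ : ℝ, 0 < ξ → ξ < ξ₀ →
            ∀ᵐ w ∂P, ∀ᶠ n : ℕ in atTop,
              (n : ℝ) ^ (-α) ≤ RCM.boxEigenvalue (fun e => ω e w)
                RCM.unitMeasure ξ (3 * (n : ℝ) ^ (-α)) n ∧
              ((RCM.holes (fun e => ω e w) ξ n).Nonempty →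
                (n : ℝ) ^ (-α) ≤ RCM.holesEigenvalue (fun e => ω e w)
                  RCM.unitMeasure ξ n)) := by
  have hi : (⟨0, by omega⟩ : Fin d) ≠ ⟨1, by omega⟩ := by simp
  have hd2 : (2 : ℝ) ≤ d := by exact_mod_cast hd
  have hd0 : (0 : ℝ) < d := by linarith
  -- For `D` disjoint obstacles, `d < βγD` must hold with `β < 2`, which is possible as soon as `d <
  -- 2γD`. Then `α` is any number strictly between `β` and `2`.
  have key : ∀ D : ℕ, 0 < γ → (d : ℝ) < 2 * γ * D →
      ∃ β α : ℝ, 0 < β ∧ β < α ∧ α < 2 ∧ (d : ℝ) < β * γ * D := by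
    intro D hγ hD
    have hD0 : (0 : ℝ) < γ * D := by nlinarith
    have h1 : (d : ℝ) / (γ * D) < 2 := by rw [div_lt_iff₀ hD0]; linarith
    have h2 : 0 < (d : ℝ) / (γ * D) := by positivity
    obtain ⟨β, hβ1, hβ2⟩ := exists_between h1
    obtain ⟨α, hα1, hα2⟩ := exists_between hβ2
    refine ⟨β, α, h2.trans hβ1, hα1, hα2, ?_⟩
    rw [div_lt_iff₀ hD0] at hβ1
    linarith
  constructor
  · intro hγ
    have hγ' : (d : ℝ) < γ * (8 * d - 4) := by
      have h3 : (0 : ℝ) < d - 1 / 2 := by linarith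
      rw [← mul_div_assoc, div_lt_iff₀ h3] at hγ
      linarith
    have hγ0 : 0 < γ := by
      by_contra! hcon
      nlinarith
    -- The condition `d < 2γ(4d - 2)` is `γ > d / (8 (d - 1/2))`.
    obtain ⟨β, α, hβ, hβα, hα, hD⟩ := key (4 * d - 2) hγ0 (by
      rw [Nat.cast_sub (by omega)]; push_cast; linarith)
    exact ⟨α, hβ.trans hβα, hα, fun Ω _ P _ ω hω => hω.csrw hγ0 hi hβ hβα hD⟩
  · intro hγ
    have hγ0 : 0 < γ := by linarith
    obtain ⟨β, α, hβ, hβα, hα, hD⟩ := key (2 * d) hγ0 (by push_cast; nlinarith)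
    exact ⟨α, hβ.trans hβα, hα, fun Ω _ P _ ω hω => hω.vsrw hγ0 hi hβ hβα hD⟩
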